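/- Let $\mathbb{K}$ be a field and let $q\in\mathbb{K}\setminus\{0\}$ not be a root of unity. Let $U=U_q(\mathfrak{sl}_2)$ be the unital associative $\mathbb{K}$-algebra with generators $E,F,K,K^{-1}$ and relations $$KK^{-1}=K^{-1}K=1,\quad KE=q^2EK,\quad KF=q^{-2}FK,\quad EF-FE=\frac{K-K^{-1}}{q-q^{-1}},$$ let $\Delta\colon U\to U\otimes U$ be the algebra morphism (coproduct) with $\Delta(E)=E\otimes 1+K\otimes E$, $\Delta(F)=F\otimes K^{-1}+1\otimes F$, $\Delta(K^{\pm1})=K^{\pm1}\otimes K^{\pm1}$, and let $\Lambda=(q-q^{-1})^2EF+q^{-1}K+qK^{-1}$. Let $\mathcal{I}_R\subseteq U$ be the subalgebra generated by $EK^{-1},F,K^{-1},\Lambda$; one has $\Delta(\mathcal I_R)\subseteq U\otimes\mathcal I_R$. Let $\tau_R\colon\mathcal{I}_R\to U\otimes\mathcal{I}_R$ be the algebra morphism with $$\tau_R(EK^{-1})=K^{-1}\otimes EK^{-1},\qquad \tau_R(\Lambda)=1\otimes\Lambda,\qquad \tau_R(K^{-1})=1\otimes K^{-1}-q^{-1}(q-q^{-1})^2F\otimes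 EK^{-1},$$ $$\tau_R(F)=K\otimes F-q^{-3}(q-q^{-1})^2F^2K\otimes EK^{-1}+q^{-1}(q+q^{-1})FK\otimes K^{-1}-q^{-1}FK\otimes\Lambda.$$ For $n\ge 0$ and $A\subseteq\{1,\dots,n\}$ define $\Lambda_A\in U^{\otimes n}$ as follows. Put $\Lambda_\varnothing=q+q^{-1}$. If $A=\{a_1<\dots<a_m\}$ with $m\ge1$, start with $\Lambda$ and, for $i=2,\dots,m$ successively, apply to the last tensor factor first $\Delta$ once and then $\tau_R$ exactly $a_i-a_{i-1}-1$ times (each time to the new last factor); this gives $X\in U^{\otimes(a_m-a_1+1)}$, and $\Lambda_A=1^{\otimes(a_1-1)}\otimes X\otimes 1^{\otimes(n-a_m)}$. Write $[X,Y]_q=qXY-q^{-1}YX$. **Theorem.** Let $A_1,A_2,A_3,A_4$ be (possibly empty) subsets of $\{1,\dots,n\}$ such that, for all $1\le i<j\le 4$, every element of $A_i$ is smaller than every element of $A_j$. Then the relation $$[\Lambda_A,\Lambda_B]_q=(q^{-2}-q^2)\Lambda_{(A\cup B)\setminus(A\cap B)}+(q-q^{-1})\left(\Lambda_{A\cap B}\Lambda_{A\cup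 B}+\Lambda_{A\setminus(A\cap B)}\Lambda_{B\setminus(A\cap B)}\right)$$ holds in $U^{\otimes n}$ in each of the three cases $$(A,B)=(A_1\cup A_2\cup A_4,\;A_2\cup A_3),\qquad (A_2\cup A_3,\;A_1\cup A_3\cup A_4),\qquad (A_1\cup A_3\cup A_4,\;A_1\cup A_2\cup A_4).$$ -/

import Mathlib

open scoped TensorProduct

namespace AskeyWilson

/-! ### The quantum group `U_q(sl_2)` as a bialgebra -/

/-- The four generators of `U_q(sl_2)`; `Kinv` stands for `K⁻¹`. -/
inductive UqGen : Type
  | E | F | K | Kinv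

/-- The defining relations of `U_q(sl_2)` on the free algebra. -/
inductive UqRel {𝕂 : Type*} [Field 𝕂] (q : 𝕂) :
    FreeAlgebra 𝕂 UqGen → FreeAlgebra 𝕂 UqGen → Prop
  | K_mul_Kinv : UqRel q (FreeAlgebra.ι 𝕂 UqGen.K * FreeAlgebra.ι 𝕂 UqGen.Kinv) 1
  | Kinv_mul_K : UqRel q (FreeAlgebra.ι 𝕂 UqGen.Kinv * FreeAlgebra.ι 𝕂 UqGen.K) 1
  | K_mul_E : UqRel q (FreeAlgebra.ι 𝕂 UqGen.K * FreeAlgebra.ι 𝕂 UqGen.E)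
      (q ^ 2 • (FreeAlgebra.ι 𝕂 UqGen.E * FreeAlgebra.ι 𝕂 UqGen.K))
  | K_mul_F : UqRel q (FreeAlgebra.ι 𝕂 UqGen.K * FreeAlgebra.ι 𝕂 UqGen.F)
      ((q ^ 2)⁻¹ • (FreeAlgebra.ι 𝕂 UqGen.F * FreeAlgebra.ι 𝕂 UqGen.K))
  | E_F : UqRel q
      (FreeAlgebra.ι 𝕂 UqGen.E * FreeAlgebra.ι 𝕂 UqGen.F
        - FreeAlgebra.ι 𝕂 UqGen.F * FreeAlgebra.ι 𝕂 UqGen.E)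
      ((q - q⁻¹)⁻¹ • (FreeAlgebra.ι 𝕂 UqGen.K - FreeAlgebra.ι 𝕂 UqGen.Kinv))

/-- The quantum group `U_q(sl_2)` over the field `𝕂`, by generators and relations. -/
def Uq {𝕂 : Type*} [Field 𝕂] (q : 𝕂) : Type _ := RingQuot (UqRel q)

noncomputable instance {𝕂 : Type*} [Field 𝕂] (q : 𝕂) : Ring (Uq q) :=
  inferInstanceAs (Ring (RingQuot (UqRel q)))

noncomputable instance {𝕂 : Type*} [Field 𝕂] (q : 𝕂) : Algebra 𝕂 (Uq q) :=
  inferInstanceAs (Algebra 𝕂 (RingQuot (UqRel q)))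

noncomputable section

variable {𝕂 : Type*} [Field 𝕂] (q : 𝕂)

/-- The quotient map from the free algebra. -/
def mkUq : FreeAlgebra 𝕂 UqGen →ₐ[𝕂] Uq q := RingQuot.mkAlgHom 𝕂 (UqRel q)

/-- The generator `E`. -/
def genE : Uq q := mkUq q (FreeAlgebra.ι 𝕂 UqGen.E)
/-- The generator `F`. -/
def genF : Uq q := mkUq q (FreeAlgebra.ι 𝕂 UqGen.F)
/-- The generator `K`. -/
def genK : Uq q := mkUq q (FreeAlgebra.ι 𝕂 UqGen.K)
/-- The generator `K⁻¹`. -/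
def genKinv : Uq q := mkUq q (FreeAlgebra.ι 𝕂 UqGen.Kinv)

theorem genK_mul_genKinv : genK q * genKinv q = 1 := by
  have h := RingQuot.mkAlgHom_rel 𝕂 (UqRel.K_mul_Kinv (q := q))
  rw [map_mul, map_one] at h
  exact h

theorem genKinv_mul_genK : genKinv q * genK q = 1 := by
  have h := RingQuot.mkAlgHom_rel 𝕂 (UqRel.Kinv_mul_K (q := q))
  rw [map_mul, map_one] at h
  exact h

theorem genK_mul_genE : genK q * genE q = q ^ 2 • (genE q * genK q) := by
  have h := RingQuot.mkAlgHom_rel 𝕂 (UqRel.K_mul_E (q := q))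
  rw [map_mul, map_smul, map_mul] at h
  exact h

theorem genK_mul_genF : genK q * genF q = (q ^ 2)⁻¹ • (genF q * genK q) := by
  have h := RingQuot.mkAlgHom_rel 𝕂 (UqRel.K_mul_F (q := q))
  rw [map_mul, map_smul, map_mul] at h
  exact h

theorem genE_genF : genE q * genF q - genF q * genE q
    = (q - q⁻¹)⁻¹ • (genK q - genKinv q) := by
  have h := RingQuot.mkAlgHom_rel 𝕂 (UqRel.E_F (q := q))
  rw [map_sub, map_mul, map_mul, map_smul, map_sub] at h
  exact h

theorem genE_mul_genKinv : genE q * genKinv q = q ^ 2 • (genKinv q * genE q) := by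
  calc genE q * genKinv q = genKinv q * (genK q * genE q) * genKinv q := by
        rw [← mul_assoc (genKinv q), genKinv_mul_genK, one_mul]
    _ = q ^ 2 • (genKinv q * genE q) := by
        rw [genK_mul_genE, mul_smul_comm, smul_mul_assoc, mul_assoc, mul_assoc,
          genK_mul_genKinv, mul_one]

/-- The Casimir element `Λ = (q - q⁻¹)² E F + q⁻¹ K + q K⁻¹`. -/
def casimir : Uq q :=
  (q - q⁻¹) ^ 2 • (genE q * genF q) + q⁻¹ • genK q + q • genKinv q

/-- The values of the coproduct on the generators. -/
def deltaGen : UqGen → Uq q ⊗[𝕂] Uq q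
  | UqGen.E => genE q ⊗ₜ 1 + genK q ⊗ₜ genE q
  | UqGen.F => genF q ⊗ₜ genKinv q + 1 ⊗ₜ genF q
  | UqGen.K => genK q ⊗ₜ genK q
  | UqGen.Kinv => genKinv q ⊗ₜ genKinv q

theorem deltaGen_rel ⦃x y : FreeAlgebra 𝕂 UqGen⦄ (h : UqRel q x y) :
    FreeAlgebra.lift 𝕂 (deltaGen q) x = FreeAlgebra.lift 𝕂 (deltaGen q) y := by
  induction h with
  | K_mul_Kinv =>
    simp [deltaGen, genK_mul_genKinv, Algebra.TensorProduct.one_def]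
  | Kinv_mul_K =>
    simp [deltaGen, genKinv_mul_genK, Algebra.TensorProduct.one_def]
  | K_mul_E =>
    simp only [map_mul, map_smul, FreeAlgebra.lift_ι_apply, deltaGen, mul_add, add_mul,
      Algebra.TensorProduct.tmul_mul_tmul, genK_mul_genE, mul_one, one_mul, smul_add,
      TensorProduct.smul_tmul', TensorProduct.tmul_smul]
  | K_mul_F =>
    simp only [map_mul, map_smul, FreeAlgebra.lift_ι_apply, deltaGen, mul_add, add_mul,
      Algebra.TensorProduct.tmul_mul_tmul, genK_mul_genF, mul_one, one_mul, smul_add,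
      TensorProduct.smul_tmul', TensorProduct.tmul_smul, genK_mul_genKinv, genKinv_mul_genK]
  | E_F =>
    have cross : (genK q * genF q) ⊗ₜ[𝕂] (genE q * genKinv q)
        = (genF q * genK q) ⊗ₜ[𝕂] (genKinv q * genE q) := by
      rw [genK_mul_genF, genE_mul_genKinv, ← TensorProduct.smul_tmul',
        TensorProduct.tmul_smul, smul_smul]
      by_cases hq : q = 0
      · have hE : genE q = 0 := by
          calc genE q = genE q * genKinv q * genK q := by
                rw [mul_assoc, genKinv_mul_genK, mul_one]
            _ = 0 := by rw [genE_mul_genKinv, hq]; simp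
        rw [hE]; simp
      · rw [inv_mul_cancel₀ (pow_ne_zero 2 hq), one_smul]
    have e1 : genE q * genF q = genF q * genE q + (q - q⁻¹)⁻¹ • (genK q - genKinv q) := by
      rw [← genE_genF]; abel
    simp only [map_mul, map_sub, map_smul, FreeAlgebra.lift_ι_apply, deltaGen, mul_add, add_mul,
      Algebra.TensorProduct.tmul_mul_tmul, mul_one, one_mul, cross, e1,
      TensorProduct.add_tmul, TensorProduct.tmul_add, TensorProduct.tmul_smul,
      ← TensorProduct.smul_tmul', TensorProduct.sub_tmul, TensorProduct.tmul_sub, smul_sub]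
    abel

/-- The coproduct `Δ : U_q(sl_2) → U_q(sl_2) ⊗ U_q(sl_2)`. -/
def delta : Uq q →ₐ[𝕂] Uq q ⊗[𝕂] Uq q :=
  RingQuot.liftAlgHom 𝕂 ⟨FreeAlgebra.lift 𝕂 (deltaGen q), deltaGen_rel q⟩

theorem delta_mkUq (x : FreeAlgebra 𝕂 UqGen) :
    delta q (mkUq q x) = FreeAlgebra.lift 𝕂 (deltaGen q) x :=
  RingQuot.liftAlgHom_mkAlgHom_apply 𝕂 _ (deltaGen_rel q) x

theorem delta_genE : delta q (genE q) = genE q ⊗ₜ 1 + genK q ⊗ₜ genE q := by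
  rw [genE, delta_mkUq, FreeAlgebra.lift_ι_apply]; rfl

theorem delta_genF : delta q (genF q) = genF q ⊗ₜ genKinv q + 1 ⊗ₜ genF q := by
  rw [genF, delta_mkUq, FreeAlgebra.lift_ι_apply]; rfl

theorem delta_genK : delta q (genK q) = genK q ⊗ₜ genK q := by
  rw [genK, delta_mkUq, FreeAlgebra.lift_ι_apply]; rfl

theorem delta_genKinv : delta q (genKinv q) = genKinv q ⊗ₜ genKinv q := by
  rw [genKinv, delta_mkUq, FreeAlgebra.lift_ι_apply]; rfl

/-! ### The left coideal subalgebra `I_R` and its coaction -/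

/-- The subalgebra `I_R` generated by `E K⁻¹`, `F`, `K⁻¹` and `Λ`. -/
def IR : Subalgebra 𝕂 (Uq q) :=
  Algebra.adjoin 𝕂 {genE q * genKinv q, genF q, genKinv q, casimir q}

/-- `E K⁻¹` as an element of `I_R`. -/
def irE : IR q := ⟨genE q * genKinv q, Algebra.subset_adjoin (by simp)⟩
/-- `F` as an element of `I_R`. -/
def irF : IR q := ⟨genF q, Algebra.subset_adjoin (by simp)⟩
/-- `K⁻¹` as an element of `I_R`. -/
def irK : IR q := ⟨genKinv q, Algebra.subset_adjoin (by simp)⟩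
/-- `Λ` as an element of `I_R`. -/
def irC : IR q := ⟨casimir q, Algebra.subset_adjoin (by simp)⟩

/-- The inclusion `U_q(sl_2) ⊗ I_R → U_q(sl_2) ⊗ U_q(sl_2)`. -/
def inclR : Uq q ⊗[𝕂] IR q →ₐ[𝕂] Uq q ⊗[𝕂] Uq q :=
  Algebra.TensorProduct.map (AlgHom.id 𝕂 (Uq q)) (IR q).val

theorem inclR_tmul (x : Uq q) (y : IR q) : inclR q (x ⊗ₜ y) = x ⊗ₜ (y : Uq q) := rfl

theorem inclR_injective : Function.Injective (inclR q) :=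
  Module.Flat.lTensor_preserves_injective_linearMap (M := Uq q)
    (IR q).val.toLinearMap Subtype.val_injective

/-- `I_R` is a left coideal: `Δ(I_R) ⊆ U_q(sl_2) ⊗ I_R`. -/
theorem delta_mem (x : IR q) : delta q (x : Uq q) ∈ (inclR q).range := by
  have h : IR q ≤ ((inclR q).range).comap (delta q) := by
    refine Algebra.adjoin_le ?_
    rintro y (rfl | rfl | rfl | rfl)
    · refine ⟨(genE q * genKinv q) ⊗ₜ irK q + 1 ⊗ₜ irE q, ?_⟩
      change inclR q _ = delta q _
      simp only [map_add, inclR_tmul, map_mul, delta_genE, delta_genKinv, add_mul,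
        Algebra.TensorProduct.tmul_mul_tmul, one_mul, genK_mul_genKinv, irK, irE]
    · refine ⟨genF q ⊗ₜ irK q + 1 ⊗ₜ irF q, ?_⟩
      change inclR q _ = delta q _
      simp only [map_add, inclR_tmul, delta_genF, irK, irF]
    · refine ⟨genKinv q ⊗ₜ irK q, ?_⟩
      change inclR q _ = delta q _
      simp only [inclR_tmul, delta_genKinv, irK]
    · refine ⟨((q - q⁻¹) ^ 2 • (genE q * genF q) + q • genKinv q - q • genK q) ⊗ₜ irK q
        + (q - q⁻¹) ^ 2 • (genE q ⊗ₜ irF q) + (q - q⁻¹) ^ 2 • ((genK q * genF q) ⊗ₜ irE q)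
        + genK q ⊗ₜ irC q, ?_⟩
      change inclR q _ = delta q _
      simp only [map_add, map_sub, map_smul, map_mul, inclR_tmul, casimir, delta_genE, delta_genF,
        delta_genK, delta_genKinv, add_mul, mul_add, Algebra.TensorProduct.tmul_mul_tmul, one_mul,
        mul_one, irK, irE, irF, irC, TensorProduct.add_tmul, TensorProduct.sub_tmul,
        TensorProduct.tmul_add, TensorProduct.tmul_smul, ← TensorProduct.smul_tmul', smul_add]
      abel
  exact h x.2

/-- The coproduct restricted to `I_R`, as an algebra morphism `I_R → U_q(sl_2) ⊗ I_R`. -/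
def deltaR : IR q →ₐ[𝕂] Uq q ⊗[𝕂] IR q :=
  ((AlgEquiv.ofInjective (inclR q) (inclR_injective q)).symm : _ →ₐ[𝕂] _).comp
    (((delta q).comp (IR q).val).codRestrict (inclR q).range (delta_mem q))

/-- `deltaR` is the restriction of `Δ`. -/
theorem inclR_deltaR (x : IR q) : inclR q (deltaR q x) = delta q (x : Uq q) := by
  have h := AlgEquiv.apply_symm_apply (AlgEquiv.ofInjective (inclR q) (inclR_injective q))
    ⟨delta q (x : Uq q), delta_mem q x⟩
  exact congrArg Subtype.val h

/-- The values on the generators of `I_R` which determine the coaction `τ_R`. -/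
def IsTauR (τ : IR q →ₐ[𝕂] Uq q ⊗[𝕂] IR q) : Prop :=
  τ (irE q) = genKinv q ⊗ₜ irE q ∧
  τ (irF q) = genK q ⊗ₜ irF q
      - ((q ^ 3)⁻¹ * (q - q⁻¹) ^ 2) • ((genF q ^ 2 * genK q) ⊗ₜ irE q)
      + (q⁻¹ * (q + q⁻¹)) • ((genF q * genK q) ⊗ₜ irK q)
      - q⁻¹ • ((genF q * genK q) ⊗ₜ irC q) ∧
  τ (irK q) = 1 ⊗ₜ irK q - (q⁻¹ * (q - q⁻¹) ^ 2) • (genF q ⊗ₜ irE q) ∧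
  τ (irC q) = 1 ⊗ₜ irC q

/-- An algebra morphism on `I_R` is determined by its values on the generators. -/
theorem IsTauR.unique {τ τ' : IR q →ₐ[𝕂] Uq q ⊗[𝕂] IR q} (h : IsTauR q τ) (h' : IsTauR q τ') :
    τ = τ' := by
  obtain ⟨h1, h2, h3, h4⟩ := h
  obtain ⟨k1, k2, k3, k4⟩ := h'
  refine AlgHom.ext_of_eq_adjoin (S := IR q) rfl ?_
  rintro x (rfl | rfl | rfl | rfl)
  · exact h1.trans k1.symm
  · exact h2.trans k2.symm
  · exact h3.trans k3.symm
  · exact h4.trans k4.symm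

open Classical in
/-- The coaction `τ_R : I_R → U_q(sl_2) ⊗ I_R`: the unique algebra morphism with the values
prescribed by `IsTauR` on the generators. (The second branch only makes the definition total.) -/
def tauR : IR q →ₐ[𝕂] Uq q ⊗[𝕂] IR q :=
  if h : ∃ τ, IsTauR q τ then h.choose else Algebra.TensorProduct.includeRight

/-! ### The right extension process -/

/-- Identification `U^{⊗k} ⊗ U = U^{⊗(k+1)}`. -/
def snoc (k : ℕ) : (⨂[𝕂]^k (Uq q)) ⊗[𝕂] Uq q →ₗ[𝕂] ⨂[𝕂]^(k + 1) (Uq q) :=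
  TensorPower.mulEquiv.toLinearMap ∘ₗ
    LinearMap.lTensor _
      (PiTensorProduct.subsingletonEquiv (R := 𝕂) (s := fun _ : Fin 1 => Uq q) 0).symm.toLinearMap

/-- The map `1^{⊗k} ⊗ f : U^{⊗k} ⊗ I_R → U^{⊗k} ⊗ (U ⊗ I_R) = U^{⊗(k+1)} ⊗ I_R`. -/
def applyLast (k : ℕ) (f : IR q →ₐ[𝕂] Uq q ⊗[𝕂] IR q) :
    (⨂[𝕂]^k (Uq q)) ⊗[𝕂] IR q →ₗ[𝕂] (⨂[𝕂]^(k + 1) (Uq q)) ⊗[𝕂] IR q :=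
  LinearMap.rTensor (IR q) (snoc q k) ∘ₗ
    (TensorProduct.assoc 𝕂 (⨂[𝕂]^k (Uq q)) (Uq q) (IR q)).symm.toLinearMap ∘ₗ
      LinearMap.lTensor (⨂[𝕂]^k (Uq q)) f.toLinearMap

/-- The successive stages of the right extension process for the set `S`, started at the
position `a`. Stage `k` lies in `U^{⊗k} ⊗ I_R`, its factors being the positions `a, …, a + k`.
Stage `0` is `Λ`. To pass from stage `k` to stage `k + 1` one applies, in the last factor
(position `a + k`), the coproduct `Δ` if `a + k ∈ S` and the coaction `τ_R` otherwise.
So between consecutive elements `s < t` of `S` one applies `Δ` once and then `τ_R` exactly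
`t - s - 1` times. -/
def stage (S : Set ℕ) (a : ℕ) : (k : ℕ) → (⨂[𝕂]^k (Uq q)) ⊗[𝕂] IR q
  | 0 => 1 ⊗ₜ irC q
  | k + 1 =>
    open Classical in
    applyLast q k (if a + k ∈ S then deltaR q else tauR q) (stage S a k)

/-- An element of `U^{⊗k} ⊗ I_R` seen inside `U^{⊗(k+1)}`. -/
def forget (k : ℕ) : (⨂[𝕂]^k (Uq q)) ⊗[𝕂] IR q →ₗ[𝕂] ⨂[𝕂]^(k + 1) (Uq q) :=
  snoc q k ∘ₗ LinearMap.lTensor (⨂[𝕂]^k (Uq q)) (IR q).val.toLinearMap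

/-- Concatenation `U^{⊗i} × U^{⊗j} → U^{⊗(i+j)}`, `(x, y) ↦ x ⊗ y`. -/
def concat {i j : ℕ} (x : ⨂[𝕂]^i (Uq q)) (y : ⨂[𝕂]^j (Uq q)) : ⨂[𝕂]^(i + j) (Uq q) :=
  TensorPower.mulEquiv (x ⊗ₜ[𝕂] y)

theorem length_eq {n a m : ℕ} (h₁ : a ≤ m) (h₂ : m < n) :
    a + (m - a + 1) + (n - 1 - m) = n := by omega

/-- The element `Λ_A ∈ U_q(sl_2)^{⊗n}` for `A ⊆ {1, …, n}`. The positions `1, …, n` are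
numbered `0, …, n - 1`. If `A` is nonempty with minimum `a` and maximum `m`, then `Λ_A` is the
final stage of the extension process for `A`, which occupies the positions `a, …, m`, with
the unit in all positions before `a` and after `m`. For the empty set, `Λ_∅ = q + q⁻¹`. -/
def Lam (n : ℕ) (A : Finset (Fin n)) : ⨂[𝕂]^n (Uq q) :=
  if h : A.Nonempty then
    let a : Fin n := A.min' h
    let m : Fin n := A.max' h
    TensorPower.cast 𝕂 (Uq q) (length_eq (Fin.le_def.mp (A.min'_le_max' h)) m.isLt)
      (concat q
        (concat q (1 : ⨂[𝕂]^(a : ℕ) (Uq q))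
          (forget q (m - a : ℕ) (stage q (Fin.val '' (A : Set (Fin n))) a (m - a : ℕ))))
        (1 : ⨂[𝕂]^(n - 1 - m : ℕ) (Uq q)))
  else algebraMap 𝕂 (⨂[𝕂]^n (Uq q)) (q + q⁻¹)

/-! ### The relations -/

/-- The `q`-commutator `[X, Y]_q = q X Y - q⁻¹ Y X`. -/
def qComm {R : Type*} [Ring R] [Algebra 𝕂 R] (X Y : R) : R :=
  q • (X * Y) - q⁻¹ • (Y * X)

/-- `A ≺ B`: every element of `A` is smaller than every element of `B`, i.e.
`max A < min B`, or `A` or `B` is empty. -/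
def Prec {n : ℕ} (A B : Finset (Fin n)) : Prop := ∀ a ∈ A, ∀ b ∈ B, a < b

/-- The standard relation between `Λ_A` and `Λ_B` in `U_q(sl_2)^{⊗n}`. -/
def StandardRelation {n : ℕ} (A B : Finset (Fin n)) : Prop :=
  qComm q (Lam q n A) (Lam q n B)
    = ((q ^ 2)⁻¹ - q ^ 2) • Lam q n ((A ∪ B) \ (A ∩ B))
      + (q - q⁻¹) • (Lam q n (A ∩ B) * Lam q n (A ∪ B)
          + Lam q n (A \ (A ∩ B)) * Lam q n (B \ (A ∩ B)))

end

end AskeyWilson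

/-!
The elements `Λ_A` are quantum traces of holonomies, and the relations are skein relations between
such traces.

The generators of `I_R` combine into a two-by-two matrix `g` (`genMat`) with quantum trace `Λ` which
solves the reflection equation and has quantum determinant one (`isHolonomy_genMat`). In terms
of `g`, the coaction `τ_R` is conjugation by an invertible matrix `ν` over the new tensor factor,
and the coproduct is the same conjugation followed by right multiplication by the `g` of that
factor (`genMatIR_map_pairing_tau`, `genMatIR_map_pairing_delta`). Hence the extension process can
be summed up: `Λ_A` is the quantum trace of the product, in decreasing order, of the holonomies
`a_i = ν_0 ⋯ ν_{i-1} g_i (ν_0 ⋯ ν_{i-1})⁻¹` with `i ∈ A` (`Lam_eq_qTrace`).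

Each `a_i` solves the reflection equation, and `a_j` precedes `a_i` for `i < j`, in the sense of the
exchange relation `Precedes`: with `s` the four-by-four Hecke crossing, `s (a_j ⊗ 1) s⁻¹` commutes
with `a_i ⊗ 1`. Both properties pass to products over sets. So the theorem reduces to four
holonomies `x₁, x₂, x₃, x₄` (of `A₄, A₃, A₂, A₁`), each preceding the next ones. A product of two traces is the
partial trace of a word in the `x_i ⊗ 1` and `s`. The exchange and reflection relations bring the
words for `Λ_A Λ_B` and `Λ_B Λ_A` to forms which differ only in crossings, and the skein relation
`s - s⁻¹ = q - q⁻¹`, the unimodularity of the shared block and the quantum Cayley–Hamilton identity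
finish the comparison (`qComm_qTrace_of_shared_third`, `qComm_qTrace_of_shared_second`,
`qComm_qTrace_of_shared_outer`).

The definition of `τ_R` as the morphism with given values on generators has content only if it
exists. It is obtained by conjugating a simple morphism `U → U ⊗ U` with the quasi-`R`-matrix
`∑ c_m F^m ⊗ E^m`, in power series over `U ⊗ U`: the generators of `I_R`, and so all of `I_R`, go to
polynomials with coefficients in `U ⊗ I_R`, which can be evaluated at `1` (`exists_isTauR`). The
coefficients `c_m` have denominators `1 - q^(2m)`; here `q` must not be a root of unity.
-/

namespace AskeyWilson

noncomputable section

/-! ### Skein calculus of two-by-two matrices -/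

section Skein

variable {𝕂 : Type*} [Field 𝕂] {𝒜 : Type*} [Ring 𝒜] [Algebra 𝕂 𝒜]

/-- Two-by-two matrices. Elements of `Mat2 (Mat2 𝒜)` are four-by-four matrices over `𝒜`,
read as operators on two strands: the outer matrix is the first strand. -/
abbrev Mat2 (R : Type*) : Type _ := Matrix (Fin 2) (Fin 2) R

/-- `x ⊗ 1`: the matrix `x` acting on the first strand. -/
def slot₁ : Mat2 𝒜 →+* Mat2 (Mat2 𝒜) := (Matrix.scalar (Fin 2)).mapMatrix

/-- `1 ⊗ x`: the matrix `x` acting on the second strand. -/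
def slot₂ : Mat2 𝒜 →+* Mat2 (Mat2 𝒜) := Matrix.scalar (Fin 2)

variable (𝒜) in
/-- The Temperley–Lieb generator: the four-by-four matrix which creates and annihilates a pair
of strands. -/
def cupCap (q : 𝕂) : Mat2 (Mat2 𝒜) :=
  !![!![0, 0; 0, q⁻¹ • 1], !![0, 0; -1, 0]; !![0, -1; 0, 0], !![q • 1, 0; 0, 0]]

variable (𝒜) in
/-- The Hecke crossing `q - e`, with `e` the Temperley–Lieb generator. -/
def crossing (q : 𝕂) : Mat2 (Mat2 𝒜) := q • 1 - cupCap 𝒜 q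

variable (𝒜) in
/-- The inverse crossing `q⁻¹ - e`. -/
def crossingInv (q : 𝕂) : Mat2 (Mat2 𝒜) := q⁻¹ • 1 - cupCap 𝒜 q

/-- The quantum trace. The entries need not commute, so it is not cyclic. -/
def qTrace (q : 𝕂) : Mat2 𝒜 →ₗ[𝕂] 𝒜 where
  toFun x := q⁻¹ • x 0 0 + q • x 1 1
  map_add' x y := by simp only [Matrix.add_apply, smul_add]; abel
  map_smul' c x := by
    simp only [Matrix.smul_apply, RingHom.id_apply, smul_add, smul_comm c]

/-- The quantum trace over the second strand. -/
def partialTrace (q : 𝕂) : Mat2 (Mat2 𝒜) →ₗ[𝕂] Mat2 𝒜 where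
  toFun M := M.map (qTrace q)
  map_add' x y := by ext; simp
  map_smul' c x := by ext; simp

theorem cupCap_mul_self {q : 𝕂} (hq : q ≠ 0) :
    cupCap 𝒜 q * cupCap 𝒜 q = (q + q⁻¹) • cupCap 𝒜 q := by
  ext i j k l
  fin_cases i <;> fin_cases j <;> fin_cases k <;> fin_cases l <;>
    simp [cupCap, Matrix.mul_apply, Fin.sum_univ_two, smul_smul, add_mul, hq, add_smul, add_comm]

theorem crossing_mul_crossingInv {q : 𝕂} (hq : q ≠ 0) :
    crossing 𝒜 q * crossingInv 𝒜 q = 1 := by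
  simp only [crossing, crossingInv, sub_mul, mul_sub, smul_mul_assoc, mul_smul_comm, one_mul,
    mul_one, cupCap_mul_self hq]
  match_scalars <;> field_simp <;> ring

theorem crossingInv_mul_crossing {q : 𝕂} (hq : q ≠ 0) :
    crossingInv 𝒜 q * crossing 𝒜 q = 1 := by
  simp only [crossing, crossingInv, sub_mul, mul_sub, smul_mul_assoc, mul_smul_comm, one_mul,
    mul_one, cupCap_mul_self hq]
  match_scalars <;> field_simp <;> ring

theorem slot₁_eq (x : Mat2 𝒜) :
    slot₁ x = !![!![x 0 0, 0; 0, x 0 0], !![x 0 1, 0; 0, x 0 1];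
      !![x 1 0, 0; 0, x 1 0], !![x 1 1, 0; 0, x 1 1]] := by
  ext i j k l
  fin_cases i <;> fin_cases j <;> fin_cases k <;> fin_cases l <;> simp [slot₁]

theorem slot₂_eq (x : Mat2 𝒜) : slot₂ x = !![x, 0; 0, x] := by
  ext i j k l
  fin_cases i <;> fin_cases j <;> simp [slot₂]

/-- A matrix caught between two cups is replaced by its quantum trace. -/
theorem cupCap_mul_slot₁_mul_cupCap {q : 𝕂} (hq : q ≠ 0) (x : Mat2 𝒜) :
    cupCap 𝒜 q * slot₁ x * cupCap 𝒜 q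
      = slot₁ (Matrix.scalar (Fin 2) (qTrace q x)) * cupCap 𝒜 q := by
  simp only [cupCap, slot₁_eq, Matrix.mul_fin_two]
  simp [qTrace, smul_smul, hq, add_comm]
  ext i
  fin_cases i <;> rfl

theorem partialTrace_slot₁_mul (q : 𝕂) (x : Mat2 𝒜) (M : Mat2 (Mat2 𝒜)) :
    partialTrace q (slot₁ x * M) = x * partialTrace q M := by
  ext i j
  simp [partialTrace, slot₁, qTrace, Matrix.mul_apply, Fin.sum_univ_two, mul_add]
  abel

theorem partialTrace_mul_slot₁ (q : 𝕂) (x : Mat2 𝒜) (M : Mat2 (Mat2 𝒜)) :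
    partialTrace q (M * slot₁ x) = partialTrace q M * x := by
  ext i j
  simp [partialTrace, slot₁, qTrace, Matrix.mul_apply, Fin.sum_univ_two, add_mul]
  abel

theorem partialTrace_one (q : 𝕂) : partialTrace q (1 : Mat2 (Mat2 𝒜)) = (q + q⁻¹) • 1 := by
  ext i j
  fin_cases i <;> fin_cases j <;> simp [partialTrace, qTrace, add_smul, add_comm]

theorem partialTrace_cupCap {q : 𝕂} (hq : q ≠ 0) : partialTrace q (cupCap 𝒜 q) = 1 := by
  ext i j
  fin_cases i <;> fin_cases j <;> simp [partialTrace, qTrace, cupCap, smul_smul, hq]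

theorem qTrace_scalar_mul (q : 𝕂) (c : 𝒜) (x : Mat2 𝒜) :
    qTrace q (Matrix.scalar (Fin 2) c * x) = c * qTrace q x := by
  simp [qTrace, mul_add]

theorem qTrace_mul_scalar (q : 𝕂) (c : 𝒜) (x : Mat2 𝒜) :
    qTrace q (x * Matrix.scalar (Fin 2) c) = qTrace q x * c := by
  simp [qTrace, add_mul]

theorem qTrace_one (q : 𝕂) : qTrace q (1 : Mat2 𝒜) = algebraMap 𝕂 𝒜 (q + q⁻¹) := by
  simp [qTrace, Algebra.algebraMap_eq_smul_one, add_smul, add_comm]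

end Skein

/-! ### Holonomies and the reflection equation -/

section Relations

variable {𝕂 : Type*} [Field 𝕂] {𝒜 : Type*} [Ring 𝒜] [Algebra 𝕂 𝒜] {q : 𝕂}

local notation "𝐬" => crossing 𝒜 q
local notation "𝐬⁻" => crossingInv 𝒜 q
local notation "𝐞" => cupCap 𝒜 q

variable (q) in
/-- A quantum `SL₂` holonomy: a matrix which solves the reflection equation, and whose quantum
determinant (the factor by which `x₁ s x₁` acts on the Temperley–Lieb generator) is that of the
identity. -/
structure IsHolonomy (x : Mat2 𝒜) : Prop where
  reflection : Commute (crossing 𝒜 q) (slot₁ x * crossing 𝒜 q * slot₁ x)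
  unimodular : slot₁ x * crossing 𝒜 q * slot₁ x * cupCap 𝒜 q = -q⁻¹ • cupCap 𝒜 q

variable (q) in
/-- The exchange relation between the holonomies `x` and `y` of loops which enclose disjoint
sets of punctures: once `x` is carried across the strand of `y`, the two commute. The relation is
not symmetric in `x` and `y`. -/
def Precedes (x y : Mat2 𝒜) : Prop :=
  Commute (crossing 𝒜 q * slot₁ x * crossingInv 𝒜 q) (slot₁ y)

theorem crossing_mul_cupCap (hq : q ≠ 0) : 𝐬 * 𝐞 = -q⁻¹ • 𝐞 := by
  simp only [crossing, sub_mul, smul_mul_assoc, one_mul, cupCap_mul_self hq]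
  module

theorem crossingInv_mul_cupCap (hq : q ≠ 0) : 𝐬⁻ * 𝐞 = -q • 𝐞 := by
  simp only [crossingInv, sub_mul, smul_mul_assoc, one_mul, cupCap_mul_self hq]
  module

theorem crossing_eq_crossingInv_add : 𝐬 = 𝐬⁻ + (q - q⁻¹) • 1 := by
  simp only [crossing, crossingInv]
  module

theorem crossingInv_mul_self (hq : q ≠ 0) :
    𝐬⁻ * 𝐬⁻ = (q⁻¹ ^ 2) • 1 + (q - q⁻¹) • 𝐞 := by
  simp only [crossingInv, sub_mul, mul_sub, mul_smul_comm, smul_mul_assoc, one_mul, mul_one,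
    cupCap_mul_self hq]
  module

theorem commute_crossingInv (hq : q ≠ 0) {M : Mat2 (Mat2 𝒜)} (h : Commute 𝐬 M) :
    Commute 𝐬⁻ M := by
  have h1 := crossing_mul_crossingInv (𝒜 := 𝒜) hq
  have h2 := crossingInv_mul_crossing (𝒜 := 𝒜) hq
  calc 𝐬⁻ * M = 𝐬⁻ * (M * 𝐬) * 𝐬⁻ := by rw [mul_assoc, mul_assoc, h1, mul_one]
    _ = M * 𝐬⁻ := by rw [← h.eq, ← mul_assoc, h2, one_mul]

theorem commute_cupCap {M : Mat2 (Mat2 𝒜)} (h : Commute 𝐬 M) : Commute 𝐞 M := by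
  have : 𝐞 = q • 1 - 𝐬 := by simp [crossing]
  rw [this]
  exact ((Commute.one_left M).smul_left q).sub_left h

namespace Precedes

theorem one_left (hq : q ≠ 0) (y : Mat2 𝒜) : Precedes q 1 y := by
  simp [Precedes, crossing_mul_crossingInv hq]

theorem one_right (x : Mat2 𝒜) : Precedes q x 1 := by
  simp [Precedes]

theorem mul_right {x y z : Mat2 𝒜} (h : Precedes q x y) (h' : Precedes q x z) :
    Precedes q x (y * z) := by
  unfold Precedes
  rw [map_mul]
  exact Commute.mul_right h h'

theorem mul_left (hq : q ≠ 0) {x y z : Mat2 𝒜} (h : Precedes q x z) (h' : Precedes q y z) :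
    Precedes q (x * y) z := by
  unfold Precedes at *
  have : 𝐬 * slot₁ (x * y) * 𝐬⁻ = (𝐬 * slot₁ x * 𝐬⁻) * (𝐬 * slot₁ y * 𝐬⁻) := by
    have h2 := crossingInv_mul_crossing (𝒜 := 𝒜) hq
    calc _ = 𝐬 * slot₁ x * 1 * slot₁ y * 𝐬⁻ := by rw [map_mul]; noncomm_ring
      _ = _ := by rw [← h2]; noncomm_ring
  rw [this]
  exact Commute.mul_left h h'

/-- A holonomy slides through a crossing past one which precedes it. -/
theorem slide (hq : q ≠ 0) {x y : Mat2 𝒜} (h : Precedes q x y) :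
    slot₁ y * 𝐬 * slot₁ x = 𝐬 * slot₁ x * 𝐬⁻ * slot₁ y * 𝐬 := by
  have h2 := crossingInv_mul_crossing (𝒜 := 𝒜) hq
  calc _ = slot₁ y * (𝐬 * slot₁ x * 𝐬⁻) * 𝐬 := by simp only [mul_assoc, h2, mul_one]
    _ = _ := by rw [← Commute.eq h]

theorem commute_conj_inv (hq : q ≠ 0) {x y : Mat2 𝒜} (h : Precedes q x y) :
    Commute (slot₁ x) (𝐬⁻ * slot₁ y * 𝐬) := by
  have h1 := crossing_mul_crossingInv (𝒜 := 𝒜) hq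
  have h2 := crossingInv_mul_crossing (𝒜 := 𝒜) hq
  calc slot₁ x * (𝐬⁻ * slot₁ y * 𝐬) = 𝐬⁻ * (𝐬 * slot₁ x * 𝐬⁻ * slot₁ y * 𝐬) := by
        simp only [← mul_assoc, h2, one_mul]
    _ = _ := by rw [← h.slide hq]; simp only [mul_assoc]

end Precedes

namespace IsHolonomy

theorem one (hq : q ≠ 0) : IsHolonomy q (1 : Mat2 𝒜) where
  reflection := by simp
  unimodular := by simp [crossing_mul_cupCap hq]

/-- Holonomies multiply as long as the first factor precedes the second. -/
theorem mul (hq : q ≠ 0) {x y : Mat2 𝒜} (hx : IsHolonomy q x) (hy : IsHolonomy q y)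
    (h : Precedes q x y) : IsHolonomy q (x * y) := by
  have key : slot₁ (x * y) * 𝐬 * slot₁ (x * y)
      = (slot₁ x * 𝐬 * slot₁ x) * 𝐬⁻ * (slot₁ y * 𝐬 * slot₁ y) := by
    calc _ = slot₁ x * (slot₁ y * 𝐬 * slot₁ x) * slot₁ y := by rw [map_mul]; noncomm_ring
      _ = _ := by rw [h.slide hq]; noncomm_ring
  constructor
  · rw [key]
    refine (hx.reflection.mul_right ?_).mul_right hy.reflection
    rw [Commute, SemiconjBy, crossing_mul_crossingInv hq, crossingInv_mul_crossing hq]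
  · rw [key, mul_assoc, hy.unimodular, mul_smul_comm, mul_assoc, crossingInv_mul_cupCap hq,
      mul_smul_comm, hx.unimodular]
    simp only [smul_smul]
    congr 1
    field_simp

theorem cupCap_mul {x : Mat2 𝒜} (hx : IsHolonomy q x) :
    𝐞 * (slot₁ x * 𝐬 * slot₁ x) = -q⁻¹ • 𝐞 := by
  rw [(commute_cupCap hx.reflection).eq, hx.unimodular]

end IsHolonomy

/-! ### Traces of products of holonomies -/

theorem partialTrace_slot₁ (x : Mat2 𝒜) :
    partialTrace q (slot₁ x) = (q + q⁻¹) • x := by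
  have := partialTrace_slot₁_mul q x 1
  rwa [mul_one, partialTrace_one, mul_smul_comm, mul_one] at this

theorem partialTrace_slot₁_mul_cupCap (hq : q ≠ 0) (x : Mat2 𝒜) :
    partialTrace q (slot₁ x * 𝐞) = x := by
  rw [partialTrace_slot₁_mul, partialTrace_cupCap hq, mul_one]

theorem partialTrace_crossing (hq : q ≠ 0) : partialTrace q 𝐬 = q ^ 2 • (1 : Mat2 𝒜) := by
  rw [crossing, map_sub, map_smul, partialTrace_one, partialTrace_cupCap hq]
  match_scalars
  field_simp
  ring

/-- A loop carried around the second strand closes up to a scalar. -/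
theorem partialTrace_conj (hq : q ≠ 0) (x : Mat2 𝒜) :
    partialTrace q (𝐬 * slot₁ x * 𝐬⁻) = Matrix.scalar (Fin 2) (qTrace q x) := by
  have h : 𝐬 * slot₁ x * 𝐬⁻ = slot₁ x - q • (slot₁ x * 𝐞) - q⁻¹ • (𝐞 * slot₁ x)
      + 𝐞 * slot₁ x * 𝐞 := by
    simp only [crossing, crossingInv, sub_mul, mul_sub, smul_mul_assoc, mul_smul_comm, one_mul,
      mul_one, smul_sub, smul_smul, inv_mul_cancel₀ hq, one_smul]
    abel
  rw [h, cupCap_mul_slot₁_mul_cupCap hq, map_add, map_sub, map_sub, map_smul, map_smul,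
    partialTrace_slot₁_mul_cupCap hq, partialTrace_slot₁_mul_cupCap hq, partialTrace_mul_slot₁,
    partialTrace_cupCap hq, partialTrace_slot₁, one_mul]
  module

theorem partialTrace_conj_inv (hq : q ≠ 0) (x : Mat2 𝒜) :
    partialTrace q (𝐬⁻ * slot₁ x * 𝐬) = Matrix.scalar (Fin 2) (qTrace q x) := by
  have h : 𝐬⁻ * slot₁ x * 𝐬 = slot₁ x - q⁻¹ • (slot₁ x * 𝐞) - q • (𝐞 * slot₁ x)
      + 𝐞 * slot₁ x * 𝐞 := by
    simp only [crossing, crossingInv, sub_mul, mul_sub, smul_mul_assoc, mul_smul_comm, one_mul,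
      mul_one, smul_sub, smul_smul, mul_inv_cancel₀ hq, one_smul]
    abel
  rw [h, cupCap_mul_slot₁_mul_cupCap hq, map_add, map_sub, map_sub, map_smul, map_smul,
    partialTrace_slot₁_mul_cupCap hq, partialTrace_slot₁_mul_cupCap hq, partialTrace_mul_slot₁,
    partialTrace_cupCap hq, partialTrace_slot₁, one_mul]
  module

/-- The quantum trace of `x` commutes with `y`: partial trace of the exchange relation over the
second strand, onto which the crossing carries `x`. -/
theorem Precedes.commute_left (hq : q ≠ 0) {x y : Mat2 𝒜} (h : Precedes q x y) :
    Commute (Matrix.scalar (Fin 2) (qTrace q x)) y := by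
  have := congrArg (partialTrace q) (Commute.eq h)
  rwa [partialTrace_slot₁_mul, partialTrace_mul_slot₁, partialTrace_conj hq] at this

theorem Precedes.commute_right (hq : q ≠ 0) {x y : Mat2 𝒜} (h : Precedes q x y) :
    Commute (Matrix.scalar (Fin 2) (qTrace q y)) x := by
  have := congrArg (partialTrace q) (h.commute_conj_inv hq).symm.eq
  rwa [partialTrace_slot₁_mul, partialTrace_mul_slot₁, partialTrace_conj_inv hq] at this

/-- The quantum trace commutes with every entry of the holonomy: partial trace of the reflection
equation. -/
theorem IsHolonomy.commute_self (hq : q ≠ 0) {x : Mat2 𝒜} (h : IsHolonomy q x) :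
    Commute (Matrix.scalar (Fin 2) (qTrace q x)) x := by
  have h1 : 𝐬⁻ * slot₁ x * 𝐬 * slot₁ x = slot₁ x * (𝐬 * slot₁ x * 𝐬⁻) := by
    have := (commute_crossingInv hq h.reflection).eq
    simpa only [mul_assoc] using this
  have := congrArg (partialTrace q) h1
  rwa [partialTrace_slot₁_mul, partialTrace_mul_slot₁, partialTrace_conj hq,
    partialTrace_conj_inv hq] at this

/-- The quantum Cayley–Hamilton identity for a holonomy. -/
theorem IsHolonomy.sq (hq : q ≠ 0) {x : Mat2 𝒜} (h : IsHolonomy q x) :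
    q • (x * x) = x * Matrix.scalar (Fin 2) (qTrace q x) - q⁻¹ • 1 := by
  have h1 : slot₁ x * 𝐬 * slot₁ x * 𝐞 = q • (slot₁ (x * x) * 𝐞)
      - slot₁ (x * Matrix.scalar (Fin 2) (qTrace q x)) * 𝐞 := by
    rw [map_mul slot₁ x (Matrix.scalar _ _), mul_assoc (slot₁ x) (slot₁ _),
      ← cupCap_mul_slot₁_mul_cupCap hq]
    simp only [crossing, sub_mul, mul_sub, smul_mul_assoc, mul_smul_comm, mul_one, map_mul,
      mul_assoc]
  rw [h.unimodular] at h1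
  have := congrArg (partialTrace q) h1
  rw [map_sub, map_smul, map_smul, partialTrace_slot₁_mul_cupCap hq,
    partialTrace_slot₁_mul_cupCap hq, partialTrace_cupCap hq] at this
  rw [neg_smul] at this
  rw [sub_eq_add_neg, this]
  abel

theorem partialTrace_slot₁_crossing_slot₁ (hq : q ≠ 0) (x : Mat2 𝒜) (y : Mat2 𝒜) :
    partialTrace q (slot₁ x * 𝐬 * slot₁ y) = q ^ 2 • (x * y) := by
  rw [partialTrace_mul_slot₁, partialTrace_slot₁_mul, partialTrace_crossing hq, mul_smul_comm,
    mul_one, smul_mul_assoc]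

theorem mul_scalar_qTrace (hq : q ≠ 0) (x y : Mat2 𝒜) :
    x * Matrix.scalar (Fin 2) (qTrace q y) = partialTrace q (slot₁ x * (𝐬 * slot₁ y * 𝐬⁻)) := by
  rw [partialTrace_slot₁_mul, partialTrace_conj hq]

theorem scalar_qTrace_mul (hq : q ≠ 0) (x y : Mat2 𝒜) :
    Matrix.scalar (Fin 2) (qTrace q y) * x = partialTrace q (𝐬⁻ * slot₁ y * 𝐬 * slot₁ x) := by
  rw [partialTrace_mul_slot₁, partialTrace_conj_inv hq]

theorem partialTrace_cupCap_crossing (hq : q ≠ 0) (x y w : Mat2 𝒜) :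
    partialTrace q (slot₁ x * 𝐞 * slot₁ y * 𝐬 * slot₁ w)
      = q • (x * y * w) - x * Matrix.scalar (Fin 2) (qTrace q y) * w := by
  have h : slot₁ x * 𝐞 * slot₁ y * 𝐬 * slot₁ w
      = q • (slot₁ x * 𝐞 * slot₁ (y * w))
        - slot₁ x * (slot₁ (Matrix.scalar (Fin 2) (qTrace q y)) * 𝐞) * slot₁ w := by
    rw [← cupCap_mul_slot₁_mul_cupCap hq]
    simp only [crossing, sub_mul, mul_sub, smul_mul_assoc, mul_smul_comm, mul_one, map_mul,
      mul_assoc]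
  rw [h, map_sub, map_smul, partialTrace_mul_slot₁, partialTrace_mul_slot₁,
    partialTrace_slot₁_mul_cupCap hq, partialTrace_slot₁_mul,
    partialTrace_slot₁_mul_cupCap hq, mul_assoc x y w]

theorem partialTrace_crossing_cupCap (hq : q ≠ 0) (x y w : Mat2 𝒜) :
    partialTrace q (slot₁ x * 𝐬 * slot₁ y * 𝐞 * slot₁ w)
      = q • (x * y * w) - x * Matrix.scalar (Fin 2) (qTrace q y) * w := by
  have h : slot₁ x * 𝐬 * slot₁ y * 𝐞 * slot₁ w
      = q • (slot₁ (x * y) * 𝐞 * slot₁ w)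
        - slot₁ x * (slot₁ (Matrix.scalar (Fin 2) (qTrace q y)) * 𝐞) * slot₁ w := by
    rw [← cupCap_mul_slot₁_mul_cupCap hq]
    simp only [crossing, sub_mul, mul_sub, smul_mul_assoc, mul_smul_comm, mul_one, map_mul,
      mul_assoc]
  rw [h, map_sub, map_smul, partialTrace_mul_slot₁, partialTrace_mul_slot₁,
    partialTrace_slot₁_mul_cupCap hq, partialTrace_slot₁_mul,
    partialTrace_slot₁_mul_cupCap hq]

section Words

variable {ℬ : Type*} [Ring ℬ] [Algebra 𝕂 ℬ] {s s' e Y : ℬ}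

/-- Resolution of a double crossing adjacent to a block `Y` that absorbs the cup `e`, together
with the exchange of the remaining crossing `s` for `s'`. Here `s` and `s'` stand for a crossing and
its inverse. -/
theorem skein_expand_left (hs : s = s' + (q - q⁻¹) • 1)
    (hss : s' * s' = (q⁻¹ ^ 2) • 1 + (q - q⁻¹) • e) (hY : Y * e = -q⁻¹ • e) (a b c : ℬ) :
    a * Y * (s' * s') * b * s * c
      = q⁻¹ ^ 2 • (a * Y * b * s' * c) + (q⁻¹ ^ 2 * (q - q⁻¹)) • (a * Y * (b * c))
        - ((q - q⁻¹) * q⁻¹) • (a * e * b * s * c) := by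
  have h1 : a * Y * (s' * s') * b * s * c
      = q⁻¹ ^ 2 • (a * Y * b * s * c) + (q - q⁻¹) • (a * (Y * e) * b * s * c) := by
    rw [hss]
    simp only [mul_add, add_mul, mul_smul_comm, smul_mul_assoc, mul_one, mul_assoc]
  have h2 : a * Y * b * s * c = a * Y * b * s' * c + (q - q⁻¹) • (a * Y * (b * c)) := by
    rw [hs]
    simp only [mul_add, add_mul, mul_smul_comm, smul_mul_assoc, mul_one, mul_assoc]
  rw [h1, h2, hY]
  simp only [mul_smul_comm, smul_mul_assoc]
  module

/-- The mirror image of `skein_expand_left`. -/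
theorem skein_expand_right (hs : s = s' + (q - q⁻¹) • 1)
    (hss : s' * s' = (q⁻¹ ^ 2) • 1 + (q - q⁻¹) • e) (hY : e * Y = -q⁻¹ • e) (a b c : ℬ) :
    a * s * b * (s' * s') * Y * c
      = q⁻¹ ^ 2 • (a * s' * b * Y * c) + (q⁻¹ ^ 2 * (q - q⁻¹)) • (a * b * Y * c)
        - ((q - q⁻¹) * q⁻¹) • (a * s * b * e * c) := by
  have h1 : a * s * b * (s' * s') * Y * c
      = q⁻¹ ^ 2 • (a * s * b * Y * c) + (q - q⁻¹) • (a * s * b * (e * Y) * c) := by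
    rw [hss]
    simp only [mul_add, add_mul, mul_smul_comm, smul_mul_assoc, mul_one, mul_assoc]
  have h2 : a * s * b * Y * c = a * s' * b * Y * c + (q - q⁻¹) • (a * b * Y * c) := by
    rw [hs]
    simp only [mul_add, add_mul, mul_smul_comm, smul_mul_assoc, mul_one, mul_assoc]
  rw [h1, h2, hY]
  simp only [mul_smul_comm, smul_mul_assoc]
  module

end Words

variable {x₁ x₂ x₃ x₄ : Mat2 𝒜}

/-- The product of two traces sharing `x₂`, as the trace of a two-strand word in which `x₂` occurs
only in the reflection block `x₂ s x₂`. -/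
theorem mul_qTrace_eq_of_precedes (hq : q ≠ 0) (h₂₄ : Precedes q x₂ x₄)
    (h₃₄ : Precedes q x₃ x₄) :
    x₁ * x₂ * x₄ * Matrix.scalar (Fin 2) (qTrace q (x₂ * x₃))
      = partialTrace q (slot₁ x₁ * (slot₁ x₂ * 𝐬 * slot₁ x₂) * slot₁ x₃ * 𝐬⁻ * slot₁ x₄) := by
  have h := ((h₂₄.mul_left hq h₃₄).symm).eq
  rw [map_mul] at h
  rw [mul_scalar_qTrace hq]
  refine congrArg (partialTrace q) ?_
  calc _ = slot₁ x₁ * slot₁ x₂ * (slot₁ x₄ * (𝐬 * (slot₁ x₂ * slot₁ x₃) * 𝐬⁻)) := by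
        simp only [map_mul, mul_assoc]
    _ = _ := by rw [h]; simp only [mul_assoc]

/-- The product in the opposite order gives the same two-strand word up to the crossings around
`x₃`. -/
theorem qTrace_mul_eq_of_precedes (hq : q ≠ 0) (h₂ : IsHolonomy q x₂) (h₁₂ : Precedes q x₁ x₂)
    (h₁₃ : Precedes q x₁ x₃) (h₂₃ : Precedes q x₂ x₃) :
    Matrix.scalar (Fin 2) (qTrace q (x₂ * x₃)) * (x₁ * x₂ * x₄)
      = partialTrace q (slot₁ x₁ * (slot₁ x₂ * 𝐬 * slot₁ x₂) * (𝐬⁻ * 𝐬⁻) * slot₁ x₃ * 𝐬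
          * slot₁ x₄) := by
  have h := ((h₁₂.mul_right h₁₃).commute_conj_inv hq).symm.eq
  have h' := (commute_crossingInv hq h₂.reflection).eq
  rw [map_mul] at h
  rw [scalar_qTrace_mul hq]
  refine congrArg (partialTrace q) ?_
  calc _ = 𝐬⁻ * (slot₁ x₂ * slot₁ x₃) * 𝐬 * slot₁ x₁ * slot₁ x₂ * slot₁ x₄ := by
        simp only [map_mul, mul_assoc]
    _ = slot₁ x₁ * 𝐬⁻ * slot₁ x₂ * (slot₁ x₃ * 𝐬 * slot₁ x₂) * slot₁ x₄ := by
        rw [h]; simp only [mul_assoc]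
    _ = slot₁ x₁ * (𝐬⁻ * (slot₁ x₂ * 𝐬 * slot₁ x₂)) * 𝐬⁻ * slot₁ x₃ * 𝐬 * slot₁ x₄ := by
        rw [h₂₃.slide hq]; simp only [mul_assoc]
    _ = _ := by rw [h']; simp only [mul_assoc]

/-- The relation between traces that share the second of four blocks. Both products of traces are
partial traces of two-strand words which differ in the crossings only; `skein_expand_left` compares
them and Cayley–Hamilton removes the square of `x₂`. -/
theorem qComm_qTrace_of_shared_second (hq : q ≠ 0) (h₂ : IsHolonomy q x₂) (h₁₂ : Precedes q x₁ x₂)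
    (h₁₃ : Precedes q x₁ x₃) (h₂₃ : Precedes q x₂ x₃) (h₂₄ : Precedes q x₂ x₄)
    (h₃₄ : Precedes q x₃ x₄) :
    qComm q (qTrace q (x₂ * x₃)) (qTrace q (x₁ * x₂ * x₄))
      = ((q ^ 2)⁻¹ - q ^ 2) • qTrace q (x₁ * x₃ * x₄)
        + (q - q⁻¹) • (qTrace q x₂ * qTrace q (x₁ * x₂ * x₃ * x₄)
          + qTrace q x₃ * qTrace q (x₁ * x₄)) := by
  have hT := congrArg (partialTrace q) (skein_expand_left crossing_eq_crossingInv_add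
    (crossingInv_mul_self hq) h₂.unimodular (slot₁ x₁) (slot₁ x₃) (slot₁ x₄))
  rw [← qTrace_mul_eq_of_precedes hq h₂ h₁₂ h₁₃ h₂₃, map_sub, map_add, map_smul, map_smul,
    map_smul, ← mul_qTrace_eq_of_precedes hq h₂₄ h₃₄,
    partialTrace_cupCap_crossing hq, ← map_mul, partialTrace_mul_slot₁, partialTrace_slot₁_mul,
    partialTrace_slot₁_crossing_slot₁ hq] at hT
  have hT' := congrArg (qTrace q) hT
  -- Cayley–Hamilton for `x₂`, whose trace commutes with `x₁` and `x₂`.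
  have e1 : x₁ * q ^ 2 • (x₂ * x₂) * (x₃ * x₄)
      = q • (Matrix.scalar (Fin 2) (qTrace q x₂) * (x₁ * x₂ * x₃ * x₄))
        - (x₁ * x₃ * x₄) := by
    have c1 := (h₁₂.commute_right hq).eq
    have c2 := (h₂.commute_self hq).eq
    rw [pow_two, mul_smul, h₂.sq hq, ← c2]
    simp only [mul_sub, sub_mul, mul_smul_comm, smul_mul_assoc, smul_sub, smul_smul,
      mul_inv_cancel₀ hq, mul_one, one_smul, ← mul_assoc, c1]
  have e2 : x₁ * Matrix.scalar (Fin 2) (qTrace q x₃) * x₄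
      = Matrix.scalar (Fin 2) (qTrace q x₃) * (x₁ * x₄) := by
    rw [← (h₁₃.commute_right hq).eq, mul_assoc]
  rw [e1, e2] at hT'
  simp only [map_sub, map_add, map_smul, qTrace_scalar_mul, qTrace_mul_scalar] at hT'
  rw [qComm, hT']
  match_scalars <;> field_simp <;> ring

/-- The relation between traces that share the third of four blocks, by `skein_expand_right`. -/
theorem qComm_qTrace_of_shared_third (hq : q ≠ 0) (h₃ : IsHolonomy q x₃) (h₁₂ : Precedes q x₁ x₂)
    (h₁₃ : Precedes q x₁ x₃) (h₂₃ : Precedes q x₂ x₃) (h₂₄ : Precedes q x₂ x₄)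
    (h₃₄ : Precedes q x₃ x₄) :
    qComm q (qTrace q (x₁ * x₃ * x₄)) (qTrace q (x₂ * x₃))
      = ((q ^ 2)⁻¹ - q ^ 2) • qTrace q (x₁ * x₂ * x₄)
        + (q - q⁻¹) • (qTrace q x₃ * qTrace q (x₁ * x₂ * x₃ * x₄)
          + qTrace q (x₁ * x₄) * qTrace q x₂) := by
  have hP : x₁ * x₃ * x₄ * Matrix.scalar (Fin 2) (qTrace q (x₂ * x₃))
      = partialTrace q (slot₁ x₁ * 𝐬 * slot₁ x₂ * (𝐬⁻ * 𝐬⁻) * (slot₁ x₃ * 𝐬 * slot₁ x₃)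
          * slot₁ x₄) := by
    have h := ((h₂₄.mul_left hq h₃₄).symm).eq
    have h' := (commute_crossingInv hq h₃.reflection).eq
    rw [map_mul] at h
    rw [mul_scalar_qTrace hq]
    refine congrArg (partialTrace q) ?_
    calc _ = slot₁ x₁ * slot₁ x₃ * (slot₁ x₄ * (𝐬 * (slot₁ x₂ * slot₁ x₃) * 𝐬⁻)) := by
          simp only [map_mul, mul_assoc]
      _ = slot₁ x₁ * (slot₁ x₃ * 𝐬 * slot₁ x₂) * slot₁ x₃ * 𝐬⁻ * slot₁ x₄ := by
          rw [h]; simp only [mul_assoc]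
      _ = slot₁ x₁ * 𝐬 * slot₁ x₂ * 𝐬⁻ * ((slot₁ x₃ * 𝐬 * slot₁ x₃) * 𝐬⁻) * slot₁ x₄ := by
          rw [h₂₃.slide hq]; simp only [mul_assoc]
      _ = _ := by rw [← h']; simp only [mul_assoc]
  have hQ : Matrix.scalar (Fin 2) (qTrace q (x₂ * x₃)) * (x₁ * x₃ * x₄)
      = partialTrace q (slot₁ x₁ * 𝐬⁻ * slot₁ x₂ * (slot₁ x₃ * 𝐬 * slot₁ x₃) * slot₁ x₄) := by
    have h := ((h₁₂.mul_right h₁₃).commute_conj_inv hq).symm.eq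
    rw [map_mul] at h
    rw [scalar_qTrace_mul hq]
    refine congrArg (partialTrace q) ?_
    calc _ = 𝐬⁻ * (slot₁ x₂ * slot₁ x₃) * 𝐬 * slot₁ x₁ * slot₁ x₃ * slot₁ x₄ := by
          simp only [map_mul, mul_assoc]
      _ = _ := by rw [h]; simp only [mul_assoc]
  have hT := congrArg (partialTrace q) (skein_expand_right crossing_eq_crossingInv_add
    (crossingInv_mul_self hq) h₃.cupCap_mul (slot₁ x₁) (slot₁ x₂) (slot₁ x₄))
  rw [← hP, map_sub, map_add, map_smul, map_smul, map_smul, ← hQ,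
    partialTrace_crossing_cupCap hq, ← map_mul, partialTrace_mul_slot₁, partialTrace_slot₁_mul,
    partialTrace_slot₁_crossing_slot₁ hq] at hT
  have hT' := congrArg (qTrace q) hT
  -- Cayley–Hamilton for `x₃`, whose trace commutes with `x₁`, `x₂` and `x₃`.
  have e1 : x₁ * x₂ * q ^ 2 • (x₃ * x₃) * x₄
      = q • (Matrix.scalar (Fin 2) (qTrace q x₃) * (x₁ * x₂ * x₃ * x₄))
        - (x₁ * x₂ * x₄) := by
    have c0 := (h₂₃.commute_right hq).eq
    have c1 := (h₁₃.commute_right hq).eq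
    have c2 := (h₃.commute_self hq).eq
    have c3 : x₁ * x₂ * Matrix.scalar (Fin 2) (qTrace q x₃)
      = Matrix.scalar (Fin 2) (qTrace q x₃) * x₁ * x₂ := by
      rw [mul_assoc, ← c0, ← mul_assoc, ← c1]
    rw [pow_two, mul_smul, h₃.sq hq, ← c2]
    simp only [mul_sub, sub_mul, mul_smul_comm, smul_mul_assoc, smul_sub, smul_smul,
      mul_inv_cancel₀ hq, mul_one, one_smul, ← mul_assoc, c3]
  have e2 : x₁ * Matrix.scalar (Fin 2) (qTrace q x₂) * x₄
      = x₁ * x₄ * Matrix.scalar (Fin 2) (qTrace q x₂) := by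
    rw [mul_assoc, (h₂₄.commute_left hq).eq, mul_assoc]
  rw [e1, e2] at hT'
  simp only [map_sub, map_add, map_smul, qTrace_scalar_mul, qTrace_mul_scalar] at hT'
  rw [qComm, hT']
  match_scalars <;> field_simp <;> ring

section Words

variable {ℬ : Type*} [Ring ℬ] [Algebra 𝕂 ℬ] {s s' e Y Z : ℬ}

/-- The expansion of a word enclosed by two blocks `Y` and `Z`, each of which absorbs the cup
`e` on its inner side. Apart from one double crossing, all
crossings cancel. -/
theorem skein_expand_two_sided (hq : q ≠ 0) (hs : s = q • 1 - e) (hs' : s' = q⁻¹ • 1 - e)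
    (hss : s' * s' = (q⁻¹ ^ 2) • 1 + (q - q⁻¹) • e) (hY : Y * e = -q⁻¹ • e)
    (hZ : e * Z = -q⁻¹ • e) (a b : ℬ) :
    q • (Y * s' * a * s * b * (s' * s') * Z) - q⁻¹ • (Y * a * s' * b * s' * Z)
      = (q - q⁻¹) • (Y * (a * b) * (s' * s') * Z) - q⁻¹ • (Y * (a * b) * e)
        + Y * a * (e * b * e) + q⁻¹ • (e * (a * b) * Z) - q⁻¹ ^ 2 • (e * a * e * b * Z)
        - (q - q⁻¹) • (e * (a * b) * e) + (q⁻¹ * (q - q⁻¹)) • (e * a * e * b * e) := by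
  have h1 : Y * s' = q⁻¹ • Y + q⁻¹ • e := by
    rw [hs', mul_sub, hY, mul_smul_comm, mul_one]
    module
  have h2 : s' * Z = q⁻¹ • Z + q⁻¹ • e := by
    rw [hs', sub_mul, hZ, smul_mul_assoc, one_mul]
    module
  have h3 : s' * s' * Z = q⁻¹ ^ 2 • Z - ((q - q⁻¹) * q⁻¹) • e := by
    rw [hss, add_mul, smul_mul_assoc, smul_mul_assoc, hZ, one_mul]
    module
  rw [mul_assoc (Y * s' * a * s * b), mul_assoc (Y * (a * b)), mul_assoc (Y * a * s' * b),
    h1, h2, h3, hs, hs']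
  simp only [mul_add, add_mul, mul_sub, sub_mul, mul_smul_comm, smul_mul_assoc, mul_one,
    mul_assoc]
  match_scalars <;> field_simp <;> ring

end Words

/-- A form of unimodularity: `x s x` next to a matrix `w` and a cup still traces to a scalar
multiple of the trace of `w`. -/
theorem qTrace_partialTrace_mul_cupCap (hq : q ≠ 0) {x : Mat2 𝒜} (hx : IsHolonomy q x)
    (w : Mat2 𝒜) :
    qTrace q (partialTrace q (slot₁ x * 𝐬 * slot₁ x * slot₁ w * 𝐞)) = -q⁻¹ • qTrace q w := by
  have h : slot₁ x * 𝐬 * slot₁ x * slot₁ w * 𝐞 = q • (slot₁ (x * x * w) * 𝐞)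
      - slot₁ (x * Matrix.scalar (Fin 2) (qTrace q (x * w))) * 𝐞 := by
    rw [map_mul slot₁ x (Matrix.scalar _ _), mul_assoc (slot₁ x) (slot₁ _),
      ← cupCap_mul_slot₁_mul_cupCap hq]
    simp only [crossing, sub_mul, mul_sub, smul_mul_assoc, mul_smul_comm, mul_one, map_mul,
      mul_assoc]
  rw [h, map_sub, map_smul, partialTrace_slot₁_mul_cupCap hq, partialTrace_slot₁_mul_cupCap hq,
    ← smul_mul_assoc, hx.sq hq, ← (hx.commute_self hq).eq, sub_mul, mul_assoc, smul_mul_assoc,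
    one_mul, map_sub, map_sub, qTrace_scalar_mul, qTrace_mul_scalar, map_smul]
  module

theorem qTrace_partialTrace_cupCap_mul (hq : q ≠ 0) {x : Mat2 𝒜} (hx : IsHolonomy q x)
    (w : Mat2 𝒜) :
    qTrace q (partialTrace q (𝐞 * slot₁ w * (slot₁ x * 𝐬 * slot₁ x))) = -q⁻¹ • qTrace q w := by
  have h : 𝐞 * slot₁ w * (slot₁ x * 𝐬 * slot₁ x) = q • (𝐞 * slot₁ (w * (x * x)))
      - slot₁ (Matrix.scalar (Fin 2) (qTrace q (w * x))) * 𝐞 * slot₁ x := by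
    rw [← cupCap_mul_slot₁_mul_cupCap hq]
    simp only [crossing, sub_mul, mul_sub, smul_mul_assoc, mul_smul_comm, mul_one, map_mul,
      mul_assoc]
  rw [h, map_sub, map_smul, partialTrace_mul_slot₁, partialTrace_mul_slot₁,
    partialTrace_cupCap hq, one_mul, partialTrace_slot₁_mul_cupCap hq,
    ← mul_smul_comm, hx.sq hq, mul_sub, ← mul_assoc, mul_smul_comm,
    mul_one, map_sub, map_sub, qTrace_scalar_mul, qTrace_mul_scalar, map_smul]
  module

/-- The product of two traces sharing `x₁` and `x₄`, as the trace of a two-strand word between the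
reflection blocks of `x₁` and `x₄`. -/
theorem mul_qTrace_both_word (hq : q ≠ 0) (h₄ : IsHolonomy q x₄) (h₁₂ : Precedes q x₁ x₂)
    (h₁₄ : Precedes q x₁ x₄) (h₃₄ : Precedes q x₃ x₄) :
    x₁ * x₂ * x₄ * Matrix.scalar (Fin 2) (qTrace q (x₁ * x₃ * x₄))
      = partialTrace q (slot₁ x₁ * 𝐬 * slot₁ x₁ * 𝐬⁻ * slot₁ x₂ * 𝐬 * slot₁ x₃ * (𝐬⁻ * 𝐬⁻)
          * (slot₁ x₄ * 𝐬 * slot₁ x₄)) := by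
  have h' := (commute_crossingInv hq h₄.reflection).eq
  have h'' := crossingInv_mul_crossing (𝒜 := 𝒜) hq
  rw [mul_scalar_qTrace hq]
  refine congrArg (partialTrace q) ?_
  calc _ = slot₁ x₁ * slot₁ x₂ * (slot₁ x₄ * 𝐬 * slot₁ x₁) * slot₁ x₃ * slot₁ x₄ * 𝐬⁻ := by
        simp only [map_mul, mul_assoc]
    _ = slot₁ x₁ * (slot₁ x₂ * 𝐬 * slot₁ x₁) * 𝐬⁻ * (slot₁ x₄ * 𝐬 * slot₁ x₃) * slot₁ x₄
          * 𝐬⁻ := by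
        rw [h₁₄.slide hq]; simp only [mul_assoc]
    _ = slot₁ x₁ * 𝐬 * slot₁ x₁ * 𝐬⁻ * slot₁ x₂ * 𝐬 * (𝐬⁻ * 𝐬) * slot₁ x₃ * 𝐬⁻
          * ((slot₁ x₄ * 𝐬 * slot₁ x₄) * 𝐬⁻) := by
        rw [h₁₂.slide hq, h₃₄.slide hq]; simp only [mul_assoc]
    _ = _ := by rw [← h', h'', mul_one]; simp only [mul_assoc]

/-- The product of `mul_qTrace_both_word` with `x₂` and `x₃` exchanged, rewritten so that `x₂`
again stands before `x₃`. -/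
theorem mul_qTrace_both_word_swap (hq : q ≠ 0) (h₄ : IsHolonomy q x₄) (h₁₃ : Precedes q x₁ x₃)
    (h₁₄ : Precedes q x₁ x₄) (h₂₃ : Precedes q x₂ x₃) (h₂₄ : Precedes q x₂ x₄) :
    x₁ * x₃ * x₄ * Matrix.scalar (Fin 2) (qTrace q (x₁ * x₂ * x₄))
      = partialTrace q (slot₁ x₁ * 𝐬 * slot₁ x₁ * slot₁ x₂ * 𝐬⁻ * slot₁ x₃ * 𝐬⁻
          * (slot₁ x₄ * 𝐬 * slot₁ x₄)) := by
  have h' := (commute_crossingInv hq h₄.reflection).eq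
  have h'' := crossingInv_mul_crossing (𝒜 := 𝒜) hq
  have h''' := crossing_mul_crossingInv (𝒜 := 𝒜) hq
  rw [mul_qTrace_both_word hq h₄ h₁₃ h₁₄ h₂₄]
  refine congrArg (partialTrace q) ?_
  calc _ = slot₁ x₁ * 𝐬 * slot₁ x₁ * 𝐬⁻ * (slot₁ x₃ * 𝐬 * slot₁ x₂) * (𝐬⁻ * 𝐬⁻)
          * (slot₁ x₄ * 𝐬 * slot₁ x₄) := by
        simp only [mul_assoc]
    _ = slot₁ x₁ * 𝐬 * slot₁ x₁ * (𝐬⁻ * 𝐬) * slot₁ x₂ * 𝐬⁻ * slot₁ x₃ * (𝐬 * 𝐬⁻) * 𝐬⁻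
          * (slot₁ x₄ * 𝐬 * slot₁ x₄) := by
        rw [h₂₃.slide hq]; simp only [mul_assoc]
    _ = _ := by rw [h'', h''', mul_one, mul_one]

theorem mul_qTrace_outer_word (hq : q ≠ 0) (h₄ : IsHolonomy q x₄)
    (h₁₄ : Precedes q x₁ x₄) (h₂₄ : Precedes q x₂ x₄) (h₃₄ : Precedes q x₃ x₄) :
    x₁ * x₄ * Matrix.scalar (Fin 2) (qTrace q (x₁ * x₂ * x₃ * x₄))
      = partialTrace q (slot₁ x₁ * 𝐬 * slot₁ x₁ * (slot₁ x₂ * slot₁ x₃) * (𝐬⁻ * 𝐬⁻)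
          * (slot₁ x₄ * 𝐬 * slot₁ x₄)) := by
  have h := mul_qTrace_both_word (x₂ := 1) (x₃ := x₂ * x₃) hq h₄ (Precedes.one_right x₁) h₁₄
    (h₂₄.mul_left hq h₃₄)
  have h'' := crossingInv_mul_crossing (𝒜 := 𝒜) hq
  rw [mul_one, ← mul_assoc x₁ x₂, map_one, mul_one, mul_assoc _ 𝐬⁻ 𝐬, h'', mul_one,
    map_mul slot₁ x₂] at h
  exact h

/-- The relation between traces that share the first and the fourth of four blocks, by
`skein_expand_two_sided`. -/
theorem qComm_qTrace_of_shared_outer (hq : q ≠ 0) (h₁ : IsHolonomy q x₁) (h₄ : IsHolonomy q x₄)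
    (h₁₂ : Precedes q x₁ x₂) (h₁₃ : Precedes q x₁ x₃) (h₁₄ : Precedes q x₁ x₄)
    (h₂₃ : Precedes q x₂ x₃) (h₂₄ : Precedes q x₂ x₄) (h₃₄ : Precedes q x₃ x₄) :
    qComm q (qTrace q (x₁ * x₂ * x₄)) (qTrace q (x₁ * x₃ * x₄))
      = ((q ^ 2)⁻¹ - q ^ 2) • qTrace q (x₂ * x₃)
        + (q - q⁻¹) • (qTrace q (x₁ * x₄) * qTrace q (x₁ * x₂ * x₃ * x₄)
          + qTrace q x₂ * qTrace q x₃) := by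
  have hT := congrArg (partialTrace q) (skein_expand_two_sided hq (crossing.eq_def 𝒜 q)
    (crossingInv.eq_def 𝒜 q) (crossingInv_mul_self hq) h₁.unimodular h₄.cupCap_mul
    (slot₁ x₂) (slot₁ x₃))
  have hT' := congrArg (qTrace q) hT
  simp only [map_sub, map_add, map_smul, ← mul_qTrace_both_word hq h₄ h₁₂ h₁₄ h₃₄,
    ← mul_qTrace_both_word_swap hq h₄ h₁₃ h₁₄ h₂₃ h₂₄, ← mul_qTrace_outer_word hq h₄ h₁₄ h₂₄ h₃₄,
    qTrace_mul_scalar] at hT'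
  have e1 := qTrace_partialTrace_mul_cupCap hq h₁ (x₂ * x₃)
  have e2 : qTrace q (partialTrace q (slot₁ x₁ * 𝐬 * slot₁ x₁ * slot₁ x₂ * (𝐞 * slot₁ x₃ * 𝐞)))
      = -q⁻¹ • (qTrace q x₂ * qTrace q x₃) := by
    rw [cupCap_mul_slot₁_mul_cupCap hq, ← qTrace_mul_scalar,
      ← qTrace_partialTrace_mul_cupCap hq h₁, map_mul slot₁ x₂]
    simp only [mul_assoc]
  have e3 := qTrace_partialTrace_cupCap_mul hq h₄ (x₂ * x₃)
  have e4 : qTrace q (partialTrace q (𝐞 * slot₁ x₂ * 𝐞 * slot₁ x₃ * (slot₁ x₄ * 𝐬 * slot₁ x₄)))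
      = -q⁻¹ • (qTrace q x₂ * qTrace q x₃) := by
    rw [cupCap_mul_slot₁_mul_cupCap hq, mul_assoc, mul_assoc, partialTrace_slot₁_mul,
      ← mul_assoc, qTrace_scalar_mul, qTrace_partialTrace_cupCap_mul hq h₄, mul_smul_comm]
  have e5 : qTrace q (partialTrace q (𝐞 * slot₁ (x₂ * x₃) * 𝐞))
      = (q + q⁻¹) • qTrace q (x₂ * x₃) := by
    rw [cupCap_mul_slot₁_mul_cupCap hq, partialTrace_slot₁_mul_cupCap hq]
    have := qTrace_scalar_mul q (qTrace q (x₂ * x₃)) 1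
    rwa [mul_one, qTrace_one, ← Algebra.commutes, ← Algebra.smul_def] at this
  have e6 : qTrace q (partialTrace q (𝐞 * slot₁ x₂ * 𝐞 * slot₁ x₃ * 𝐞))
      = (q + q⁻¹) • (qTrace q x₂ * qTrace q x₃) := by
    rw [cupCap_mul_slot₁_mul_cupCap hq, mul_assoc, mul_assoc, ← mul_assoc 𝐞,
      cupCap_mul_slot₁_mul_cupCap hq, ← mul_assoc, ← map_mul, ← map_mul,
      partialTrace_slot₁_mul_cupCap hq]
    have := qTrace_scalar_mul q (qTrace q x₂ * qTrace q x₃) 1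
    rwa [mul_one, qTrace_one, ← Algebra.commutes, ← Algebra.smul_def] at this
  rw [← map_mul slot₁ x₂, e1, e2, e3, e4, e5, e6] at hT'
  rw [qComm, hT']
  match_scalars <;> field_simp <;> ring

end Relations

/-! ### The generating matrix of `I_R` -/

section Holonomy

variable {𝕂 : Type*} [Field 𝕂] {𝒜 : Type*} [Ring 𝒜] [Algebra 𝕂 𝒜] {q : 𝕂}

theorem add_fin_two {R : Type*} [Add R] (a b c d a' b' c' d' : R) :
    !![a, b; c, d] + !![a', b'; c', d'] = !![a + a', b + b'; c + c', d + d'] := by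
  ext i j
  fin_cases i <;> fin_cases j <;> rfl

theorem smul_fin_two {R S : Type*} [SMul S R] (t : S) (a b c d : R) :
    t • !![a, b; c, d] = !![t • a, t • b; t • c, t • d] := by
  ext i j
  fin_cases i <;> fin_cases j <;> rfl

theorem crossing_eq (q : 𝕂) : crossing 𝒜 q
    = !![!![q • 1, 0; 0, (q - q⁻¹) • 1], !![0, 0; 1, 0];
        !![0, 1; 0, 0], !![0, 0; 0, q • 1]] := by
  ext i j k l
  fin_cases i <;> fin_cases j <;> fin_cases k <;> fin_cases l <;>
    simp [crossing, cupCap, sub_smul]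

theorem fin_two_congr {R : Type*} {a b c d a' b' c' d' : R} (h₁ : a = a') (h₂ : b = b')
    (h₃ : c = c') (h₄ : d = d') : !![a, b; c, d] = !![a', b'; c', d'] := by
  rw [h₁, h₂, h₃, h₄]

/-- The reflection equation and unimodularity, entry by entry. -/
theorem isHolonomy_of_relations (hq : q ≠ 0) {a b c d : 𝒜} (hba : b * a = q ^ 2 • (a * b))
    (hca : c * a = (q ^ 2)⁻¹ • (a * c)) (hda : d * a = a * d)
    (hdb : d * b = b * d + (1 - (q ^ 2)⁻¹) • (a * b))
    (hdc : d * c = c * d + ((q ^ 4)⁻¹ - (q ^ 2)⁻¹) • (a * c))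
    (hbc : b * c = a * d - (q ^ 2)⁻¹ • 1 + ((q ^ 2)⁻¹ - 1) • (a * a))
    (hcb : c * b = (q ^ 2)⁻¹ • (a * d) - (q ^ 2)⁻¹ • 1) :
    IsHolonomy q !![a, b; c, d] := by
  have key : slot₁ !![a, b; c, d] * crossing 𝒜 q * slot₁ !![a, b; c, d]
      = !![!![q • (a * a), b * a; a * c, (q - q⁻¹) • (a * a) + q • (b * c)],
        !![q • (a * b), b * b; a * d, (q - q⁻¹) • (a * b) + q • (b * d)];
      !![q • (c * a), d * a; c * c, (q - q⁻¹) • (c * a) + q • (d * c)],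
        !![q • (c * b), d * b; c * d, (q - q⁻¹) • (c * b) + q • (d * d)]] := by
    simp only [crossing_eq, slot₁_eq, Matrix.mul_fin_two, add_fin_two, mul_zero, zero_mul,
      add_zero, zero_add, mul_one, smul_mul_assoc, mul_smul_comm, Matrix.of_apply,
      Matrix.cons_val', Matrix.cons_val_zero, Matrix.cons_val_one, Matrix.cons_val_fin_one,
      smul_zero]
  constructor
  · rw [Commute, SemiconjBy, key]
    simp only [crossing_eq, Matrix.mul_fin_two, add_fin_two, mul_zero, zero_mul, add_zero,
      zero_add, mul_one, one_mul, smul_mul_assoc, mul_smul_comm, smul_zero, smul_add, smul_smul,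
      hba, hca, hda, hdb, hdc, hbc, hcb]
    refine fin_two_congr (fin_two_congr ?_ ?_ ?_ ?_) (fin_two_congr ?_ ?_ ?_ ?_)
      (fin_two_congr ?_ ?_ ?_ ?_) (fin_two_congr ?_ ?_ ?_ ?_) <;>
    match_scalars <;> field_simp <;> ring
  · rw [key]
    simp only [cupCap, Matrix.mul_fin_two, add_fin_two, smul_fin_two, mul_zero, add_zero, zero_add,
      mul_one, mul_smul_comm, smul_zero, smul_add, smul_smul, mul_neg, hba, hca, hda, hdb,
      hdc, hbc, hcb]
    refine fin_two_congr (fin_two_congr ?_ ?_ ?_ ?_) (fin_two_congr ?_ ?_ ?_ ?_)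
      (fin_two_congr ?_ ?_ ?_ ?_) (fin_two_congr ?_ ?_ ?_ ?_) <;>
    match_scalars <;> field_simp <;> ring

variable (q)

/-- The generating matrix of `I_R`: its entries are `K⁻¹`, `E K⁻¹`, `F` and a combination of `Λ` and
`K⁻¹`, normalized so that its quantum trace is `Λ`. -/
def genMat : Mat2 (Uq q) :=
  !![genKinv q, ((q ^ 3)⁻¹ * (q - q⁻¹) ^ 2) • (genE q * genKinv q);
    genF q, q⁻¹ • casimir q - (q ^ 2)⁻¹ • genKinv q]

theorem mul_lower_unitriangular {R : Type*} [Ring R] {x k k' : R} (h : k * k' = 1) :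
    (!![1, 0; x, k] : Mat2 R) * !![1, 0; -(k' * x), k'] = 1 := by
  rw [Matrix.mul_fin_two, Matrix.one_fin_two]
  simp [← mul_assoc, h]

theorem lower_unitriangular_mul {R : Type*} [Ring R] {x k k' : R} (h : k' * k = 1) :
    (!![1, 0; -(k' * x), k'] : Mat2 R) * !![1, 0; x, k] = 1 := by
  rw [Matrix.mul_fin_two, Matrix.one_fin_two, h]
  simp

/-- The matrix by which the coaction conjugates the generating matrix of the next factor. -/
def transportMat : (Mat2 (Uq q))ˣ where
  val := !![1, 0; genF q * genK q, genK q]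
  inv := !![1, 0; -(genKinv q * (genF q * genK q)), genKinv q]
  val_inv := mul_lower_unitriangular (genK_mul_genKinv q)
  inv_val := lower_unitriangular_mul (genKinv_mul_genK q)

/-- The companion of `transportMat` on the second strand: the tensor product of the two commutes
with the crossing. -/
def twistedTransportMat : (Mat2 (Uq q))ˣ where
  val := !![1, 0; q • (genF q * genK q), genK q]
  inv := !![1, 0; -(genKinv q * q • (genF q * genK q)), genKinv q]
  val_inv := mul_lower_unitriangular (genK_mul_genKinv q)
  inv_val := lower_unitriangular_mul (genKinv_mul_genK q)

/-- The matrix that `genMat` becomes on the second strand when carried across a crossing and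
the transport. -/
def oppMat : Mat2 (Uq q) :=
  !![q⁻¹ • casimir q - (q ^ 2)⁻¹ • genK q, ((q ^ 4)⁻¹ * (q - q⁻¹) ^ 2) • genE q;
    q • (genF q * genK q), genK q]

variable {q}

theorem genKinv_mul_genF (hq : q ≠ 0) : genKinv q * genF q = q ^ 2 • (genF q * genKinv q) := by
  have h : genF q * genK q = q ^ 2 • (genK q * genF q) := by
    rw [genK_mul_genF, smul_smul, mul_inv_cancel₀ (pow_ne_zero 2 hq), one_smul]
  calc genKinv q * genF q = genKinv q * (genF q * genK q) * genKinv q := by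
        rw [mul_assoc, mul_assoc (genF q), genK_mul_genKinv, mul_one]
    _ = _ := by
        rw [h, mul_smul_comm, ← mul_assoc, genKinv_mul_genK, one_mul, smul_mul_assoc]

theorem genE_mul_genK (hq : q ≠ 0) : genE q * genK q = (q ^ 2)⁻¹ • (genK q * genE q) := by
  rw [genK_mul_genE, smul_smul, inv_mul_cancel₀ (pow_ne_zero 2 hq), one_smul]

theorem genE_mul_genF : genE q * genF q
    = genF q * genE q + (q - q⁻¹)⁻¹ • (genK q - genKinv q) := by
  rw [← genE_genF]; abel

theorem genK_mul_genKinv_assoc (x : Uq q) : genK q * (genKinv q * x) = x := by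
  rw [← mul_assoc, genK_mul_genKinv, one_mul]

theorem genKinv_mul_genK_assoc (x : Uq q) : genKinv q * (genK q * x) = x := by
  rw [← mul_assoc, genKinv_mul_genK, one_mul]

theorem genK_mul_genF_assoc (x : Uq q) :
    genK q * (genF q * x) = (q ^ 2)⁻¹ • (genF q * (genK q * x)) := by
  rw [← mul_assoc, genK_mul_genF, smul_mul_assoc, mul_assoc]

theorem genKinv_mul_genF_assoc (hq : q ≠ 0) (x : Uq q) :
    genKinv q * (genF q * x) = q ^ 2 • (genF q * (genKinv q * x)) := by
  rw [← mul_assoc, genKinv_mul_genF hq, smul_mul_assoc, mul_assoc]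

theorem genE_mul_genK_assoc (hq : q ≠ 0) (x : Uq q) :
    genE q * (genK q * x) = (q ^ 2)⁻¹ • (genK q * (genE q * x)) := by
  rw [← mul_assoc, genE_mul_genK hq, smul_mul_assoc, mul_assoc]

theorem genE_mul_genKinv_assoc (x : Uq q) :
    genE q * (genKinv q * x) = q ^ 2 • (genKinv q * (genE q * x)) := by
  rw [← mul_assoc, genE_mul_genKinv, smul_mul_assoc, mul_assoc]

theorem genE_mul_genF_assoc (x : Uq q) : genE q * (genF q * x)
    = genF q * (genE q * x) + (q - q⁻¹)⁻¹ • (genK q * x - genKinv q * x) := by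
  rw [← mul_assoc, genE_mul_genF, add_mul, smul_mul_assoc, mul_assoc, sub_mul]

theorem sub_inv_ne_zero (hq : ∀ k : ℕ, 0 < k → q ^ k ≠ 1) (hq₀ : q ≠ 0) : q - q⁻¹ ≠ 0 := by
  intro h
  refine hq 2 two_pos ?_
  rw [sub_eq_zero] at h
  rw [pow_two]
  nth_rewrite 2 [h]
  exact mul_inv_cancel₀ hq₀

theorem isHolonomy_genMat (hq : q ≠ 0) : IsHolonomy q (genMat q) := by
  apply isHolonomy_of_relations hq
  all_goals simp only [casimir, mul_add, add_mul, mul_sub, sub_mul, smul_mul_assoc, mul_smul_comm,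
    smul_add, smul_sub, smul_smul, mul_assoc, genK_mul_genKinv, genKinv_mul_genK,
    genK_mul_genKinv_assoc, genKinv_mul_genK_assoc, genK_mul_genF, genKinv_mul_genF hq,
    genE_mul_genK hq, genE_mul_genKinv, genE_mul_genF, genKinv_mul_genF_assoc hq,
    genE_mul_genKinv_assoc, genE_mul_genF_assoc]
  all_goals match_scalars <;> field_simp <;> ring

theorem crossing_commute_transport (hq : q ≠ 0) : Commute (crossing (Uq q) q)
    (slot₁ (transportMat q : Mat2 (Uq q)) * slot₂ (twistedTransportMat q : Mat2 (Uq q))) := by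
  rw [Commute, SemiconjBy, transportMat, twistedTransportMat]
  simp only [crossing_eq, slot₁_eq, slot₂_eq, Matrix.mul_fin_two, add_fin_two, mul_zero, zero_mul,
    add_zero, zero_add, mul_one, one_mul, smul_mul_assoc, mul_smul_comm, Matrix.of_apply,
    Matrix.cons_val', Matrix.cons_val_zero, Matrix.cons_val_one, Matrix.cons_val_fin_one,
    smul_zero, smul_smul, mul_assoc, genK_mul_genF_assoc]
  refine fin_two_congr (fin_two_congr ?_ ?_ ?_ ?_) (fin_two_congr ?_ ?_ ?_ ?_)
    (fin_two_congr ?_ ?_ ?_ ?_) (fin_two_congr ?_ ?_ ?_ ?_) <;>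
  match_scalars <;> field_simp <;> ring

theorem crossingInv_eq (q : 𝕂) : crossingInv 𝒜 q
    = !![!![q⁻¹ • 1, 0; 0, 0], !![0, 0; 1, 0];
        !![0, 1; 0, 0], !![(q⁻¹ - q) • 1, 0; 0, q⁻¹ • 1]] := by
  ext i j k l
  fin_cases i <;> fin_cases j <;> fin_cases k <;> fin_cases l <;>
    simp [crossingInv, cupCap, sub_smul]

theorem crossingInv_genMat_crossing_transport (hq : q ≠ 0) :
    crossingInv (Uq q) q * slot₁ (genMat q) * crossing (Uq q) q
        * (slot₁ (transportMat q : Mat2 (Uq q)) * slot₂ (twistedTransportMat q : Mat2 (Uq q)))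
      = slot₁ (transportMat q : Mat2 (Uq q)) * slot₂ (twistedTransportMat q : Mat2 (Uq q))
        * slot₂ (oppMat q) := by
  rw [transportMat, twistedTransportMat, genMat, oppMat]
  simp only [crossing_eq, crossingInv_eq, slot₁_eq, slot₂_eq, Matrix.mul_fin_two, add_fin_two,
    mul_zero, zero_mul,
    add_zero, zero_add, mul_one, one_mul, smul_mul_assoc, mul_smul_comm, Matrix.of_apply,
    Matrix.cons_val', Matrix.cons_val_zero, Matrix.cons_val_one, Matrix.cons_val_fin_one,
    smul_zero, smul_add, smul_sub, smul_smul, mul_assoc, casimir, mul_add, add_mul, mul_sub,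
    sub_mul, genK_mul_genKinv, genKinv_mul_genK,
    genKinv_mul_genK_assoc,
    genE_mul_genK hq, genE_mul_genKinv, genE_mul_genF, genKinv_mul_genF_assoc hq,
    genE_mul_genF_assoc, genK_mul_genF_assoc, genE_mul_genK_assoc hq]
  refine fin_two_congr (fin_two_congr ?_ ?_ ?_ ?_) (fin_two_congr ?_ ?_ ?_ ?_)
    (fin_two_congr ?_ ?_ ?_ ?_) (fin_two_congr ?_ ?_ ?_ ?_) <;>
  match_scalars <;> field_simp <;> ring

end Holonomy

/-! ### Transport past one site -/

section Sites

variable {𝕂 : Type*} [Field 𝕂] {𝒜 : Type*} [Ring 𝒜] [Algebra 𝕂 𝒜] {q : 𝕂}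

section Map

variable {ℬ : Type*} [Ring ℬ] [Algebra 𝕂 ℬ] (f : ℬ →ₐ[𝕂] 𝒜)

theorem slot₁_map (x : Mat2 ℬ) :
    slot₁ (f.mapMatrix x) = f.mapMatrix.mapMatrix (slot₁ x) := by
  simp only [slot₁_eq]
  ext i j k l
  fin_cases i <;> fin_cases j <;> fin_cases k <;> fin_cases l <;> simp

theorem slot₂_map (x : Mat2 ℬ) :
    slot₂ (f.mapMatrix x) = f.mapMatrix.mapMatrix (slot₂ x) := by
  simp only [slot₂_eq]
  ext i j k l
  fin_cases i <;> fin_cases j <;> simp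

theorem cupCap_map (q : 𝕂) : (f.mapMatrix.mapMatrix (cupCap ℬ q) : Mat2 (Mat2 𝒜)) = cupCap 𝒜 q := by
  ext i j k l
  fin_cases i <;> fin_cases j <;> fin_cases k <;> fin_cases l <;> simp [cupCap]

theorem crossing_map (q : 𝕂) :
    (f.mapMatrix.mapMatrix (crossing ℬ q) : Mat2 (Mat2 𝒜)) = crossing 𝒜 q := by
  rw [crossing, crossing, map_sub, map_smul, map_one, cupCap_map]

theorem crossingInv_map (q : 𝕂) :
    (f.mapMatrix.mapMatrix (crossingInv ℬ q) : Mat2 (Mat2 𝒜)) = crossingInv 𝒜 q := by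
  rw [crossingInv, crossingInv, map_sub, map_smul, map_one, cupCap_map]

theorem IsHolonomy.map {x : Mat2 ℬ} (hx : IsHolonomy q x) : IsHolonomy q (f.mapMatrix x) where
  reflection := by
    have := hx.reflection.map (f.mapMatrix.mapMatrix : Mat2 (Mat2 ℬ) →ₐ[𝕂] Mat2 (Mat2 𝒜))
    rwa [map_mul, map_mul, crossing_map, ← slot₁_map] at this
  unimodular := by
    have := congrArg (f.mapMatrix.mapMatrix : Mat2 (Mat2 ℬ) →ₐ[𝕂] Mat2 (Mat2 𝒜)) hx.unimodular
    rwa [map_mul, map_mul, map_mul, map_smul, crossing_map, cupCap_map, ← slot₁_map] at this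

end Map

theorem slot₁_commute_slot₂ {x y : Mat2 𝒜} (h : ∀ i j k l, Commute (x i j) (y k l)) :
    Commute (slot₁ x) (slot₂ y) := by
  rw [Commute, SemiconjBy]
  ext i j k l
  simp [slot₁, slot₂, (h i j k l).eq]

/-- Conjugation by a unit of a monoid. -/
def unitConj {M : Type*} [Monoid M] (ν : Mˣ) (x : M) : M := (ν : M) * x * (↑ν⁻¹ : M)

theorem unitConj_mul_unitConj {M : Type*} [Monoid M] (ν : Mˣ) (x y : M) :
    unitConj ν x * unitConj ν y = unitConj ν (x * y) := by
  simp only [unitConj, mul_assoc, Units.inv_mul_cancel_left]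

theorem unitConj_mul {M : Type*} [Monoid M] (ν μ : Mˣ) (x : M) :
    unitConj (ν * μ) x = unitConj ν (unitConj μ x) := by
  simp only [unitConj, mul_assoc, mul_inv_rev, Units.val_mul]

theorem unitConj_of_commute {M : Type*} [Monoid M] {ν : Mˣ} {x : M} (h : Commute x ν) :
    unitConj ν x = x := by
  rw [unitConj, ← h.eq, mul_assoc, Units.mul_inv, mul_one]

theorem commute_unitConj {M : Type*} [Monoid M] {s x : M} {ρ : Mˣ} (hs : Commute s ρ)
    (h : Commute s x) : Commute s (unitConj ρ x) :=
  (hs.mul_right h).mul_right hs.units_inv_right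

theorem Commute.unitConj {M : Type*} [Monoid M] {x y : M} (h : Commute x y) (ρ : Mˣ) :
    Commute (unitConj ρ x) (unitConj ρ y) := by
  rw [Commute, SemiconjBy, unitConj_mul_unitConj, unitConj_mul_unitConj, h.eq]

section Conj

variable {ν ν' : (Mat2 𝒜)ˣ} {x y : Mat2 𝒜}

/-- The unit `ν ⊗ ν'` acting on both strands. -/
def doubleUnit (ν ν' : (Mat2 𝒜)ˣ) : (Mat2 (Mat2 𝒜))ˣ :=
  Units.map slot₁.toMonoidHom ν * Units.map slot₂.toMonoidHom ν'

theorem slot₁_unitConj (hx : Commute (slot₁ x) (slot₂ (ν' : Mat2 𝒜))) :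
    slot₁ (unitConj ν x) = unitConj (doubleUnit ν ν') (slot₁ x) := by
  have h : unitConj (Units.map (slot₂ (𝒜 := 𝒜)).toMonoidHom ν') (slot₁ x) = slot₁ x :=
    unitConj_of_commute hx
  rw [doubleUnit, unitConj_mul, h, unitConj, unitConj, map_mul, map_mul]
  rfl

/-- Conjugation by `ν` preserves holonomies if `ν ⊗ ν'` commutes with the crossing and `1 ⊗ ν'`
with the holonomy. Over a noncommutative ring `ν'` need not be equal to `ν`. -/
theorem IsHolonomy.conj (hx : IsHolonomy q x)
    (hν : Commute (crossing 𝒜 q) (doubleUnit ν ν'))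
    (hxν : Commute (slot₁ x) (slot₂ (ν' : Mat2 𝒜))) :
    IsHolonomy q (unitConj ν x) := by
  have hs : unitConj (doubleUnit ν ν') (crossing 𝒜 q) = crossing 𝒜 q := unitConj_of_commute hν
  have e : slot₁ (unitConj ν x) * crossing 𝒜 q * slot₁ (unitConj ν x)
      = unitConj (doubleUnit ν ν') (slot₁ x * crossing 𝒜 q * slot₁ x) := by
    rw [slot₁_unitConj hxν, ← unitConj_mul_unitConj, ← unitConj_mul_unitConj, hs]
  constructor
  · rw [e]
    exact commute_unitConj hν hx.reflection
  · have he : unitConj (doubleUnit ν ν') (cupCap 𝒜 q) = cupCap 𝒜 q :=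
      unitConj_of_commute (commute_cupCap hν)
    rw [e]
    nth_rewrite 1 [← he]
    rw [unitConj_mul_unitConj, hx.unimodular, unitConj, mul_smul_comm, smul_mul_assoc]
    exact congrArg _ he

theorem Precedes.conj (hq : q ≠ 0) (hxy : Precedes q x y)
    (hν : Commute (crossing 𝒜 q) (doubleUnit ν ν'))
    (hxν : Commute (slot₁ x) (slot₂ (ν' : Mat2 𝒜)))
    (hyν : Commute (slot₁ y) (slot₂ (ν' : Mat2 𝒜))) :
    Precedes q (unitConj ν x) (unitConj ν y) := by
  have hs : unitConj (doubleUnit ν ν') (crossing 𝒜 q) = crossing 𝒜 q := unitConj_of_commute hν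
  have hs' : unitConj (doubleUnit ν ν') (crossingInv 𝒜 q) = crossingInv 𝒜 q :=
    unitConj_of_commute (commute_crossingInv hq hν)
  have := Commute.unitConj hxy (doubleUnit ν ν')
  rwa [← unitConj_mul_unitConj, ← unitConj_mul_unitConj, hs, hs', ← slot₁_unitConj hxν,
    ← slot₁_unitConj hyν] at this

end Conj

variable (φ : Uq q →ₐ[𝕂] 𝒜)

/-- The transport matrix of the site embedded by `φ`. -/
def siteTransport : (Mat2 𝒜)ˣ := Units.map φ.mapMatrix.toMonoidHom (transportMat q)

/-- The twisted transport matrix of the site embedded by `φ`. -/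
def siteTwisted : (Mat2 𝒜)ˣ := Units.map φ.mapMatrix.toMonoidHom (twistedTransportMat q)

/-- All entries of `x` commute with the image of `φ`. -/
def CommutesWithSite (x : Mat2 𝒜) : Prop := ∀ u i j, Commute (φ u) (x i j)

theorem crossing_commute_site (hq : q ≠ 0) :
    Commute (crossing 𝒜 q) (doubleUnit (siteTransport φ) (siteTwisted φ)) := by
  have := (crossing_commute_transport hq).map
    (φ.mapMatrix.mapMatrix : Mat2 (Mat2 (Uq q)) →ₐ[𝕂] Mat2 (Mat2 𝒜))
  rwa [map_mul, crossing_map, ← slot₁_map, ← slot₂_map] at this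

variable {φ}

theorem CommutesWithSite.commute_slot₂ {x : Mat2 𝒜} (hx : CommutesWithSite φ x)
    (y : Mat2 (Uq q)) : Commute (slot₁ x) (slot₂ (φ.mapMatrix y)) :=
  slot₁_commute_slot₂ fun _ _ _ _ => (hx _ _ _).symm

theorem CommutesWithSite.mul {x y : Mat2 𝒜} (hx : CommutesWithSite φ x)
    (hy : CommutesWithSite φ y) : CommutesWithSite φ (x * y) := fun u i j => by
  rw [Matrix.mul_apply]
  exact Commute.sum_right _ _ _ fun k _ => (hx u i k).mul_right (hy u k j)

theorem commutesWithSite_map {ψ : Uq q →ₐ[𝕂] 𝒜} (h : ∀ u v, Commute (φ u) (ψ v))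
    (y : Mat2 (Uq q)) : CommutesWithSite φ (ψ.mapMatrix y) := fun u _ _ => h u _

theorem CommutesWithSite.unitConj {ψ : Uq q →ₐ[𝕂] 𝒜} (h : ∀ u v, Commute (φ u) (ψ v))
    {x : Mat2 𝒜} (hx : CommutesWithSite φ x) :
    CommutesWithSite φ (unitConj (siteTransport ψ) x) :=
  ((commutesWithSite_map h _).mul hx).mul (commutesWithSite_map h _)

theorem CommutesWithSite.commute_siteTwisted {x : Mat2 𝒜} (hx : CommutesWithSite φ x) :
    Commute (slot₁ x) (slot₂ (siteTwisted φ : Mat2 𝒜)) :=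
  hx.commute_slot₂ (twistedTransportMat q)

theorem IsHolonomy.conj_site (hq : q ≠ 0) {x : Mat2 𝒜} (hx : IsHolonomy q x)
    (hφ : CommutesWithSite φ x) : IsHolonomy q (unitConj (siteTransport φ) x) :=
  hx.conj (crossing_commute_site φ hq) hφ.commute_siteTwisted

theorem Precedes.conj_site (hq : q ≠ 0) {x y : Mat2 𝒜} (h : Precedes q x y)
    (hx : CommutesWithSite φ x) (hy : CommutesWithSite φ y) :
    Precedes q (AskeyWilson.unitConj (siteTransport φ) x)
      (AskeyWilson.unitConj (siteTransport φ) y) :=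
  h.conj hq (crossing_commute_site φ hq) hx.commute_siteTwisted hy.commute_siteTwisted

/-- If conjugation by `ρ` turns `h` into `s' g s`, and `a` commutes with `h`, then the conjugate
of `a`, carried across the crossing, commutes with `g`. -/
theorem commute_conj_of_mul_eq {M : Type*} [Monoid M] {s s' a g r h : M} {ρ : Mˣ}
    (hs : s * s' = 1) (hr : (ρ : M) = r) (h₁ : s' * g * s * r = r * h) (h₂ : Commute a h) :
    Commute (s * unitConj ρ a * s') g := by
  have e : unitConj ρ h = s' * g * s := by
    rw [unitConj, hr, ← h₁, ← hr, mul_assoc, Units.mul_inv, mul_one]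
  have c : Commute (unitConj ρ a) (s' * g * s) := e ▸ Commute.unitConj h₂ ρ
  calc s * unitConj ρ a * s' * g = s * (unitConj ρ a * (s' * g * s)) * s' := by
        simp only [mul_assoc, hs, mul_one]
    _ = g * (s * unitConj ρ a * s') := by
        rw [c.eq]
        simp only [← mul_assoc, hs, one_mul]

/-- A matrix supported away from a site, once transported past it, precedes the generating matrix
of the site. -/
theorem CommutesWithSite.precedes (hq : q ≠ 0) {x : Mat2 𝒜} (hx : CommutesWithSite φ x) :
    Precedes q (AskeyWilson.unitConj (siteTransport φ) x) (φ.mapMatrix (genMat q)) := by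
  have h := congrArg (φ.mapMatrix.mapMatrix : Mat2 (Mat2 (Uq q)) →ₐ[𝕂] Mat2 (Mat2 𝒜))
    (crossingInv_genMat_crossing_transport hq)
  simp only [map_mul, crossing_map, crossingInv_map, ← slot₁_map, ← slot₂_map] at h
  unfold Precedes
  rw [slot₁_unitConj (ν := siteTransport φ) hx.commute_siteTwisted]
  exact commute_conj_of_mul_eq (crossing_mul_crossingInv hq) rfl h (hx.commute_slot₂ _)

theorem siteTransport_val (φ : Uq q →ₐ[𝕂] 𝒜) :
    (siteTransport φ : Mat2 𝒜) = !![1, 0; φ (genF q * genK q), φ (genK q)] := by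
  ext i j
  fin_cases i <;> fin_cases j <;> simp [siteTransport, transportMat]

theorem siteTransport_inv (hq : q ≠ 0) (φ : Uq q →ₐ[𝕂] 𝒜) :
    (↑(siteTransport φ)⁻¹ : Mat2 𝒜) = !![1, 0; -(q ^ 2 • φ (genF q)), φ (genKinv q)] := by
  have : genKinv q * (genF q * genK q) = q ^ 2 • genF q := by
    rw [genKinv_mul_genF_assoc hq, genKinv_mul_genK, mul_one]
  ext i j
  fin_cases i <;> fin_cases j <;> simp [siteTransport, transportMat, this]

theorem qTrace_conj_site (hq : q ≠ 0) {x : Mat2 𝒜} (hx : CommutesWithSite φ x) :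
    qTrace q (AskeyWilson.unitConj (siteTransport φ) x) = qTrace q x := by
  have c3 : φ (genF q * genK q) * x 0 1 * φ (genKinv q) = x 0 1 * φ (genF q) := by
    rw [(hx (genF q * genK q) 0 1).eq, mul_assoc, ← map_mul, mul_assoc, genK_mul_genKinv, mul_one]
  have c4 : φ (genK q) * x 1 1 * φ (genKinv q) = x 1 1 := by
    rw [(hx (genK q) 1 1).eq, mul_assoc, ← map_mul, genK_mul_genKinv, map_one, mul_one]
  have e0 : AskeyWilson.unitConj (siteTransport φ) x 0 0
      = x 0 0 - q ^ 2 • (x 0 1 * φ (genF q)) := by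
    rw [AskeyWilson.unitConj, siteTransport_val, siteTransport_inv hq]
    simp only [Matrix.mul_apply, Fin.sum_univ_two, Matrix.of_apply, Matrix.cons_val',
      Matrix.cons_val_zero, Matrix.cons_val_one, Matrix.cons_val_fin_one, zero_mul, add_zero,
      one_mul, mul_one, mul_neg, mul_smul_comm, sub_eq_add_neg]
  have e1 : AskeyWilson.unitConj (siteTransport φ) x 1 1
      = x 0 1 * φ (genF q) + x 1 1 := by
    rw [AskeyWilson.unitConj, siteTransport_val, siteTransport_inv hq, ← c3, ← c4]
    simp only [Matrix.mul_apply, Fin.sum_univ_two, Matrix.of_apply, Matrix.cons_val',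
      Matrix.cons_val_zero, Matrix.cons_val_one, Matrix.cons_val_fin_one, mul_zero, zero_add,
      add_mul, c4]
  simp only [qTrace, LinearMap.coe_mk, AddHom.coe_mk, e0, e1]
  match_scalars <;> field_simp <;> ring

end Sites

/-! ### Holonomies along a chain of sites -/

section Path

variable {𝕂 : Type*} [Field 𝕂] {𝒜 : Type*} [Ring 𝒜] [Algebra 𝕂 𝒜] {q : 𝕂}

variable (φ : ℕ → Uq q →ₐ[𝕂] 𝒜)

/-- The product of the transport matrices of the sites `0, …, k - 1`. -/
def pathTransport : ℕ → (Mat2 𝒜)ˣ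
  | 0 => 1
  | k + 1 => pathTransport k * siteTransport (φ k)

theorem unitConj_pathTransport_succ (k : ℕ) (x : Mat2 𝒜) :
    unitConj (pathTransport φ (k + 1)) x
      = unitConj (pathTransport φ k) (unitConj (siteTransport (φ k)) x) :=
  unitConj_mul _ _ _

/-- The holonomy of the site `k`: its generating matrix, transported past all earlier sites. -/
def holonomy (k : ℕ) : Mat2 𝒜 := unitConj (pathTransport φ k) ((φ k).mapMatrix (genMat q))

open Classical in
/-- The product of the holonomies of the sites of `S` below `k`, in decreasing order. -/
def setHolonomy (S : Set ℕ) : ℕ → Mat2 𝒜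
  | 0 => 1
  | k + 1 => if k ∈ S then holonomy φ k * setHolonomy S k else setHolonomy S k

variable {φ}

/-- The images of different sites commute elementwise. -/
def SitesCommute (φ : ℕ → Uq q →ₐ[𝕂] 𝒜) : Prop := ∀ i j, i ≠ j → ∀ u v, Commute (φ i u) (φ j v)

theorem IsHolonomy.conj_path (hφ : SitesCommute φ) (hq : q ≠ 0) (k : ℕ) {x : Mat2 𝒜}
    (hx : IsHolonomy q x) (h : ∀ i < k, CommutesWithSite (φ i) x) :
    IsHolonomy q (unitConj (pathTransport φ k) x) := by
  induction k generalizing x with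
  | zero => rwa [pathTransport, unitConj_of_commute (Commute.one_right x)]
  | succ k ih =>
    rw [unitConj_pathTransport_succ]
    exact ih (hx.conj_site hq (h k k.lt_succ_self)) fun i hi =>
      (h i (hi.trans k.lt_succ_self)).unitConj (hφ i k hi.ne)

theorem Precedes.conj_path (hφ : SitesCommute φ) (hq : q ≠ 0) (k : ℕ) {x y : Mat2 𝒜}
    (h : Precedes q x y) (hx : ∀ i < k, CommutesWithSite (φ i) x)
    (hy : ∀ i < k, CommutesWithSite (φ i) y) :
    Precedes q (unitConj (pathTransport φ k) x) (unitConj (pathTransport φ k) y) := by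
  induction k generalizing x y with
  | zero =>
    rwa [pathTransport, unitConj_of_commute (Commute.one_right x),
      unitConj_of_commute (Commute.one_right y)]
  | succ k ih =>
    rw [unitConj_pathTransport_succ, unitConj_pathTransport_succ]
    exact ih (h.conj_site hq (hx k k.lt_succ_self) (hy k k.lt_succ_self))
      (fun i hi => (hx i (hi.trans k.lt_succ_self)).unitConj (hφ i k hi.ne))
      (fun i hi => (hy i (hi.trans k.lt_succ_self)).unitConj (hφ i k hi.ne))

theorem qTrace_conj_path (hφ : SitesCommute φ) (hq : q ≠ 0) (k : ℕ) {x : Mat2 𝒜}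
    (h : ∀ i < k, CommutesWithSite (φ i) x) :
    qTrace q (unitConj (pathTransport φ k) x) = qTrace q x := by
  induction k generalizing x with
  | zero => rw [pathTransport, unitConj_of_commute (Commute.one_right x)]
  | succ k ih =>
    rw [unitConj_pathTransport_succ, ih fun i hi =>
      (h i (hi.trans k.lt_succ_self)).unitConj (hφ i k hi.ne),
      qTrace_conj_site hq (h k k.lt_succ_self)]

/-- Transport past `k` sites is transport past the first `i` of them, applied to a matrix which
still commutes with those. -/
theorem exists_unitConj_pathTransport_eq (hφ : SitesCommute φ) {i k : ℕ} (hik : i ≤ k) {x : Mat2 𝒜}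
    (hx : ∀ l < k, CommutesWithSite (φ l) x) :
    ∃ y : Mat2 𝒜, (∀ l < i, CommutesWithSite (φ l) y) ∧
      unitConj (pathTransport φ k) x = unitConj (pathTransport φ i) y := by
  induction k, hik using Nat.le_induction generalizing x with
  | base => exact ⟨x, hx, rfl⟩
  | succ k hik ih =>
    rw [unitConj_pathTransport_succ]
    exact ih fun l hl => (hx l (hl.trans k.lt_succ_self)).unitConj (hφ l k hl.ne)

theorem commutesWithSite_genMat (hφ : SitesCommute φ) {i k : ℕ} (h : i ≠ k) :
    CommutesWithSite (φ i) ((φ k).mapMatrix (genMat q)) :=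
  commutesWithSite_map (hφ i k h) _

theorem isHolonomy_holonomy (hφ : SitesCommute φ) (hq : q ≠ 0) (k : ℕ) :
    IsHolonomy q (holonomy φ k) :=
  IsHolonomy.conj_path hφ hq k ((isHolonomy_genMat hq).map (φ k)) fun _ hi =>
    commutesWithSite_genMat hφ hi.ne

/-- Later sites precede earlier ones. -/
theorem precedes_holonomy (hφ : SitesCommute φ) (hq : q ≠ 0) {i j : ℕ} (hij : i < j) :
    Precedes q (holonomy φ j) (holonomy φ i) := by
  obtain ⟨y, hy, e⟩ := exists_unitConj_pathTransport_eq hφ (Nat.succ_le_of_lt hij)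
    (x := (φ j).mapMatrix (genMat q)) fun l hl => commutesWithSite_genMat hφ hl.ne
  rw [holonomy, holonomy, e, unitConj_pathTransport_succ]
  exact Precedes.conj_path hφ hq i ((hy i i.lt_succ_self).precedes hq)
    (fun l hl => (hy l (hl.trans i.lt_succ_self)).unitConj (hφ l i hl.ne))
    (fun l hl => commutesWithSite_genMat hφ hl.ne)

theorem precedes_setHolonomy_right {x : Mat2 𝒜} {S : Set ℕ} : ∀ {k : ℕ},
    (∀ i ∈ S, i < k → Precedes q x (holonomy φ i)) → Precedes q x (setHolonomy φ S k)
  | 0, _ => Precedes.one_right x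
  | k + 1, h => by
    have ih := precedes_setHolonomy_right (k := k) fun i hi hik => h i hi (hik.trans k.lt_succ_self)
    rw [setHolonomy]
    split_ifs with hk
    · exact (h k hk k.lt_succ_self).mul_right ih
    · exact ih

theorem precedes_setHolonomy_left (hq : q ≠ 0) {y : Mat2 𝒜} {T : Set ℕ} : ∀ {k : ℕ},
    (∀ j ∈ T, j < k → Precedes q (holonomy φ j) y) → Precedes q (setHolonomy φ T k) y
  | 0, _ => Precedes.one_left hq y
  | k + 1, h => by
    have ih := precedes_setHolonomy_left hq (k := k) fun i hi hik =>
      h i hi (hik.trans k.lt_succ_self)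
    rw [setHolonomy]
    split_ifs with hk
    · exact (h k hk k.lt_succ_self).mul_left hq ih
    · exact ih

theorem setHolonomy_of_forall_le {S : Set ℕ} : ∀ {k : ℕ}, (∀ i ∈ S, k ≤ i) →
    setHolonomy φ S k = 1
  | 0, _ => rfl
  | k + 1, h => by
    rw [setHolonomy, if_neg fun hk => (h k hk).not_gt k.lt_succ_self]
    exact setHolonomy_of_forall_le fun i hi => (h i hi).trans' k.le_succ

theorem setHolonomy_of_forall_lt {S : Set ℕ} {m k : ℕ} (h : ∀ i ∈ S, i < m) (hmk : m ≤ k) :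
    setHolonomy φ S k = setHolonomy φ S m := by
  induction k, hmk using Nat.le_induction with
  | base => rfl
  | succ k hmk ih => rw [setHolonomy, if_neg fun hk => (h k hk).not_ge hmk, ih]

theorem setHolonomy_union {S T : Set ℕ} (h : ∀ i ∈ S, ∀ j ∈ T, i < j) : ∀ k : ℕ,
    setHolonomy φ (S ∪ T) k = setHolonomy φ T k * setHolonomy φ S k
  | 0 => (mul_one 1).symm
  | k + 1 => by
    have ih := setHolonomy_union h k
    rw [setHolonomy, setHolonomy, setHolonomy]
    by_cases hS : k ∈ S
    · have hT : ∀ j ∈ T, k ≤ j := fun j hj => (h k hS j hj).le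
      have hT' : k ∉ T := fun hk => (h k hS k hk).false
      rw [if_pos (Set.mem_union_left T hS), if_neg hT', if_pos hS, ih,
        setHolonomy_of_forall_le hT, one_mul, one_mul]
    · by_cases hT : k ∈ T
      · rw [if_pos (Set.mem_union_right S hT), if_pos hT, if_neg hS, ih, mul_assoc]
      · rw [if_neg (by simp [hS, hT]), if_neg hT, if_neg hS, ih]

theorem isHolonomy_setHolonomy (hφ : SitesCommute φ) (hq : q ≠ 0) (S : Set ℕ) (k : ℕ) :
    IsHolonomy q (setHolonomy φ S k) := by
  induction k with
  | zero => exact IsHolonomy.one hq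
  | succ k ih =>
    rw [setHolonomy]
    split_ifs with hk
    · exact (isHolonomy_holonomy hφ hq k).mul hq ih
        (precedes_setHolonomy_right fun i _ hik => precedes_holonomy hφ hq hik)
    · exact ih

theorem precedes_setHolonomy (hφ : SitesCommute φ) (hq : q ≠ 0) {S T : Set ℕ}
    (h : ∀ i ∈ S, ∀ j ∈ T, i < j) (k : ℕ) :
    Precedes q (setHolonomy φ T k) (setHolonomy φ S k) :=
  precedes_setHolonomy_left hq fun _ hj _ => precedes_setHolonomy_right fun _ hi _ =>
    precedes_holonomy hφ hq (h _ hi _ hj)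

end Path

/-! ### Coproduct and coaction on the generating matrix -/

section Coaction

variable {𝕂 : Type*} [Field 𝕂] (q : 𝕂)

theorem deltaR_eq_of_inclR {x : IR q} {t : Uq q ⊗[𝕂] IR q} (h : inclR q t = delta q (x : Uq q)) :
    deltaR q x = t :=
  inclR_injective q ((inclR_deltaR q x).trans h.symm)

theorem deltaR_irE : deltaR q (irE q)
    = (genE q * genKinv q) ⊗ₜ irK q + 1 ⊗ₜ irE q := by
  apply deltaR_eq_of_inclR
  simp only [map_add, inclR_tmul, map_mul, delta_genE, delta_genKinv, add_mul,
    Algebra.TensorProduct.tmul_mul_tmul, one_mul, genK_mul_genKinv, irK, irE]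

theorem deltaR_irF : deltaR q (irF q) = genF q ⊗ₜ irK q + 1 ⊗ₜ irF q := by
  apply deltaR_eq_of_inclR
  simp only [map_add, inclR_tmul, delta_genF, irK, irF]

theorem deltaR_irK : deltaR q (irK q) = genKinv q ⊗ₜ irK q := by
  apply deltaR_eq_of_inclR
  simp only [inclR_tmul, delta_genKinv, irK]

theorem deltaR_irC : deltaR q (irC q)
    = ((q - q⁻¹) ^ 2 • (genE q * genF q) + q • genKinv q - q • genK q) ⊗ₜ irK q
        + (q - q⁻¹) ^ 2 • (genE q ⊗ₜ irF q) + (q - q⁻¹) ^ 2 • ((genK q * genF q) ⊗ₜ irE q)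
        + genK q ⊗ₜ irC q := by
  apply deltaR_eq_of_inclR
  simp only [map_add, map_sub, map_smul, map_mul, inclR_tmul, casimir, delta_genE, delta_genF,
    delta_genK, delta_genKinv, add_mul, mul_add, Algebra.TensorProduct.tmul_mul_tmul, one_mul,
    mul_one, irK, irE, irF, irC, TensorProduct.add_tmul, TensorProduct.sub_tmul,
    TensorProduct.tmul_add, TensorProduct.tmul_smul, ← TensorProduct.smul_tmul', smul_add]
  abel

/-- The generating matrix with entries in `I_R`. -/
def genMatIR : Mat2 (IR q) :=
  !![irK q, ((q ^ 3)⁻¹ * (q - q⁻¹) ^ 2) • irE q; irF q, q⁻¹ • irC q - (q ^ 2)⁻¹ • irK q]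

theorem genMatIR_map : (IR q).val.mapMatrix (genMatIR q) = genMat q := by
  ext i j
  fin_cases i <;> fin_cases j <;> simp [genMat, genMatIR, irE, irK, irF, irC]

theorem qTrace_genMatIR {𝒜 : Type*} [Ring 𝒜] [Algebra 𝕂 𝒜] (hq : q ≠ 0) (β : IR q →ₗ[𝕂] 𝒜) :
    qTrace q ((genMatIR q).map β) = β (irC q) := by
  simp only [qTrace, genMatIR, LinearMap.coe_mk, AddHom.coe_mk, Matrix.map_apply, Matrix.of_apply,
    Matrix.cons_val', Matrix.cons_val_zero, Matrix.cons_val_one, Matrix.cons_val_fin_one, map_sub,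
    map_smul]
  match_scalars <;> field_simp <;> ring

variable {q} {𝒜 : Type*} [Ring 𝒜] [Algebra 𝕂 𝒜]

/-- The linear map `u ⊗ w ↦ φ u * β w`. -/
def pairing (φ : Uq q →ₐ[𝕂] 𝒜) (β : IR q →ₗ[𝕂] 𝒜) : Uq q ⊗[𝕂] IR q →ₗ[𝕂] 𝒜 :=
  TensorProduct.lift ((LinearMap.mul 𝕂 𝒜).compl₁₂ φ.toLinearMap β)

theorem pairing_tmul (φ : Uq q →ₐ[𝕂] 𝒜) (β : IR q →ₗ[𝕂] 𝒜) (u : Uq q) (w : IR q) :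
    pairing φ β (u ⊗ₜ w) = φ u * β w := rfl

theorem commute_pairing {a : 𝒜} {φ : Uq q →ₐ[𝕂] 𝒜} {β : IR q →ₗ[𝕂] 𝒜}
    (hφ : ∀ u, Commute a (φ u)) (hβ : ∀ w, Commute a (β w)) (t : Uq q ⊗[𝕂] IR q) :
    Commute a (pairing φ β t) := by
  induction t with
  | zero => rw [map_zero]; exact Commute.zero_right a
  | tmul u w => exact (hφ u).mul_right (hβ w)
  | add x y hx hy => rw [map_add]; exact hx.add_right hy

theorem commutesWithSite_genMatIR_map {φ : Uq q →ₐ[𝕂] 𝒜} {β : IR q →ₗ[𝕂] 𝒜}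
    (h : ∀ u w, Commute (φ u) (β w)) : CommutesWithSite φ ((genMatIR q).map β) :=
  fun u _ _ => h u _

/-- The coaction acts on the generating matrix as conjugation by the transport matrix. -/
theorem genMatIR_map_pairing_tau (hq : q ≠ 0) {τ : IR q →ₐ[𝕂] Uq q ⊗[𝕂] IR q} (hτ : IsTauR q τ)
    {φ : Uq q →ₐ[𝕂] 𝒜} {β : IR q →ₗ[𝕂] 𝒜} (h : ∀ u w, Commute (φ u) (β w)) :
    (genMatIR q).map (pairing φ β ∘ₗ τ.toLinearMap)
      = unitConj (siteTransport φ) ((genMatIR q).map β) := by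
  obtain ⟨h1, h2, h3, h4⟩ := hτ
  have hc : ∀ u w, β w * φ u = φ u * β w := fun u w => (h u w).eq.symm
  have hm : ∀ u v x, φ u * (φ v * x) = φ (u * v) * x := fun u v x => by
    rw [map_mul, mul_assoc]
  rw [unitConj, siteTransport_val, siteTransport_inv hq, Matrix.eta_fin_two (Matrix.map _ _),
    Matrix.eta_fin_two (Matrix.map _ β)]
  simp only [Matrix.mul_fin_two]
  refine fin_two_congr ?_ ?_ ?_ ?_ <;>
  simp only [genMatIR, Matrix.map_apply, Matrix.of_apply, Matrix.cons_val', Matrix.cons_val_zero,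
    Matrix.cons_val_one, Matrix.cons_val_fin_one, LinearMap.comp_apply, AlgHom.toLinearMap_apply,
    map_sub, map_smul, map_add, h1, h2, h3, h4, pairing_tmul, map_one, one_mul, mul_one,
    zero_mul, mul_zero, add_zero, zero_add, mul_add, add_mul, mul_sub, sub_mul, mul_neg,
    mul_smul_comm, smul_mul_assoc, smul_add, smul_sub, smul_smul, mul_assoc, hc, hm,
    genK_mul_genKinv, genK_mul_genF, pow_two (genF q)]
  all_goals match_scalars <;> field_simp

/-- The coproduct acts on the generating matrix as the coaction followed by multiplication by the
generating matrix of the new site. -/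
theorem genMatIR_map_pairing_delta (hq : q ≠ 0)
    {φ : Uq q →ₐ[𝕂] 𝒜} {β : IR q →ₗ[𝕂] 𝒜} (h : ∀ u w, Commute (φ u) (β w)) :
    (genMatIR q).map (pairing φ β ∘ₗ (deltaR q).toLinearMap)
      = unitConj (siteTransport φ) ((genMatIR q).map β) * φ.mapMatrix (genMat q) := by
  have hc : ∀ u w, β w * φ u = φ u * β w := fun u w => (h u w).eq.symm
  have hm : ∀ u v x, φ u * (φ v * x) = φ (u * v) * x := fun u v x => by
    rw [map_mul, mul_assoc]
  rw [unitConj, siteTransport_val, siteTransport_inv hq, Matrix.eta_fin_two (Matrix.map _ _),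
    Matrix.eta_fin_two (Matrix.map _ β), Matrix.eta_fin_two (φ.mapMatrix _)]
  simp only [Matrix.mul_fin_two]
  refine fin_two_congr ?_ ?_ ?_ ?_ <;>
  simp only [genMatIR, genMat, casimir, AlgHom.mapMatrix_apply, Matrix.map_apply, Matrix.of_apply,
    Matrix.cons_val', Matrix.cons_val_zero,
    Matrix.cons_val_one, Matrix.cons_val_fin_one, LinearMap.comp_apply, AlgHom.toLinearMap_apply,
    map_sub, map_smul, map_add, deltaR_irE, deltaR_irF, deltaR_irK, deltaR_irC, pairing_tmul,
    map_one, one_mul, mul_one,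
    zero_mul, mul_zero, add_zero, zero_add, mul_add, add_mul, mul_sub, sub_mul, mul_neg, neg_mul,
    mul_smul_comm, smul_mul_assoc, smul_add, smul_sub, smul_smul, mul_assoc, hc, hm,
    genK_mul_genKinv, genKinv_mul_genK, genK_mul_genKinv_assoc,
    genK_mul_genF, genKinv_mul_genF hq,
    genE_mul_genKinv, genE_mul_genF, genKinv_mul_genF_assoc hq]
  all_goals match_scalars <;> field_simp <;> ring

end Coaction

/-! ### Evaluation of the extension process -/

section Evaluation

variable {𝕂 : Type*} [Field 𝕂] {q : 𝕂} {𝒜 : Type*} [Ring 𝒜] [Algebra 𝕂 𝒜]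

variable (φ : ℕ → Uq q →ₐ[𝕂] 𝒜)

/-- The linear map `x₀ ⊗ ⋯ ⊗ x_{k-1} ↦ φ_a(x₀) ⋯ φ_{a+k-1}(x_{k-1})`. -/
def tensorEval (a k : ℕ) : (⨂[𝕂]^k (Uq q)) →ₗ[𝕂] 𝒜 :=
  PiTensorProduct.lift ((MultilinearMap.mkPiAlgebraFin 𝕂 k 𝒜).compLinearMap
    fun i => (φ (a + i)).toLinearMap)

theorem tensorEval_tprod (a k : ℕ) (x : Fin k → Uq q) :
    tensorEval φ a k (PiTensorProduct.tprod 𝕂 x)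
      = (List.ofFn fun i : Fin k => φ (a + i) (x i)).prod := by
  rw [tensorEval, PiTensorProduct.lift.tprod, MultilinearMap.compLinearMap_apply,
    MultilinearMap.mkPiAlgebraFin_apply]
  rfl

theorem tensorEval_one (a k : ℕ) : tensorEval φ a k 1 = 1 := by
  rw [PiTensorProduct.one_def, tensorEval_tprod]
  exact List.prod_eq_one (by simp)

theorem tensorEval_concat (a i j : ℕ) (x : ⨂[𝕂]^i (Uq q)) (y : ⨂[𝕂]^j (Uq q)) :
    tensorEval φ a (i + j) (concat q x y) = tensorEval φ a i x * tensorEval φ (a + i) j y := by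
  induction x using PiTensorProduct.induction_on with
  | smul_tprod r x =>
    induction y using PiTensorProduct.induction_on with
    | smul_tprod s y =>
      have h := TensorPower.tprod_mul_tprod 𝕂 x y
      have h' : concat q (PiTensorProduct.tprod 𝕂 x) (PiTensorProduct.tprod 𝕂 y)
          = PiTensorProduct.tprod 𝕂 (Fin.append x y) := h
      have h'' : concat q (r • PiTensorProduct.tprod 𝕂 x) (s • PiTensorProduct.tprod 𝕂 y)
          = r • s • PiTensorProduct.tprod 𝕂 (Fin.append x y) := by
        rw [← h']
        simp only [concat, TensorProduct.tmul_smul, ← TensorProduct.smul_tmul', map_smul]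
        rw [smul_comm]
      rw [h'']
      simp only [map_smul, tensorEval_tprod, smul_mul_assoc, mul_smul_comm]
      rw [smul_comm]
      congr 2
      rw [← List.prod_append, ← List.ofFn_fin_append]
      congr 2
      funext l
      refine Fin.addCases (fun l => ?_) (fun l => ?_) l
      · simp
      · simp [add_assoc]
    | add y y' hy hy' =>
      simp only [concat, TensorProduct.tmul_add, map_add, mul_add] at hy hy' ⊢
      rw [hy, hy']
  | add x x' hx hx' =>
    simp only [concat, TensorProduct.add_tmul, map_add, add_mul] at hx hx' ⊢
    rw [hx, hx']

theorem tensorEval_cast (a : ℕ) {i j : ℕ} (h : i = j) (x : ⨂[𝕂]^i (Uq q)) :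
    tensorEval φ a j (TensorPower.cast 𝕂 (Uq q) h x) = tensorEval φ a i x := by
  subst h
  rw [TensorPower.cast_refl]
  rfl

theorem tensorEval_snoc (a k : ℕ) (y : ⨂[𝕂]^k (Uq q)) (u : Uq q) :
    tensorEval φ a (k + 1) (snoc q k (y ⊗ₜ u)) = tensorEval φ a k y * φ (a + k) u := by
  have h := tensorEval_concat φ a k 1 y
    ((PiTensorProduct.subsingletonEquiv (R := 𝕂) (s := fun _ : Fin 1 => Uq q) 0).symm u)
  have h1 : (PiTensorProduct.subsingletonEquiv (R := 𝕂) (s := fun _ : Fin 1 => Uq q) 0).symm u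
      = PiTensorProduct.tprod 𝕂 fun _ : Fin 1 => u := by
    rw [LinearEquiv.symm_apply_eq]
    simp
  rw [h1, tensorEval_tprod] at h
  have h2 : snoc q k (y ⊗ₜ u) = concat q y (PiTensorProduct.tprod 𝕂 fun _ : Fin 1 => u) := by
    rw [← h1]; rfl
  rw [h2, h]
  simp

/-- Evaluation of the first `k` factors at the sites `a, …, a + k - 1`, and of the factor in
`I_R` by `β`. -/
def stageEval (a k : ℕ) (β : IR q →ₗ[𝕂] 𝒜) : (⨂[𝕂]^k (Uq q)) ⊗[𝕂] IR q →ₗ[𝕂] 𝒜 :=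
  TensorProduct.lift ((LinearMap.mul 𝕂 𝒜).compl₁₂ (tensorEval φ a k) β)

theorem stageEval_tmul (a k : ℕ) (β : IR q →ₗ[𝕂] 𝒜) (y : ⨂[𝕂]^k (Uq q)) (w : IR q) :
    stageEval φ a k β (y ⊗ₜ w) = tensorEval φ a k y * β w := rfl

theorem stageEval_applyLast (a k : ℕ) (β : IR q →ₗ[𝕂] 𝒜) (f : IR q →ₐ[𝕂] Uq q ⊗[𝕂] IR q)
    (t : (⨂[𝕂]^k (Uq q)) ⊗[𝕂] IR q) :
    stageEval φ a (k + 1) β (applyLast q k f t)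
      = stageEval φ a k (pairing (φ (a + k)) β ∘ₗ f.toLinearMap) t := by
  induction t with
  | zero => simp only [map_zero]
  | add x y hx hy => simp only [map_add, hx, hy]
  | tmul y w =>
    rw [stageEval_tmul, applyLast]
    simp only [LinearMap.comp_apply, LinearMap.lTensor_tmul, AlgHom.toLinearMap_apply,
      LinearEquiv.coe_coe]
    induction f w with
    | zero => simp only [LinearMap.map_zero, LinearEquiv.map_zero, TensorProduct.tmul_zero,
      mul_zero]
    | add x y hx hy =>
      simp only [LinearMap.map_add, LinearEquiv.map_add, TensorProduct.tmul_add, mul_add, hx, hy]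
    | tmul u w' =>
      rw [TensorProduct.assoc_symm_tmul, LinearMap.rTensor_tmul, stageEval_tmul, tensorEval_snoc,
        pairing_tmul, mul_assoc]

theorem stageEval_forget (a k : ℕ) (t : (⨂[𝕂]^k (Uq q)) ⊗[𝕂] IR q) :
    tensorEval φ a (k + 1) (forget q k t)
      = stageEval φ a k ((φ (a + k)).toLinearMap ∘ₗ (IR q).val.toLinearMap) t := by
  induction t with
  | zero => simp only [map_zero]
  | add x y hx hy => simp only [map_add, hx, hy]
  | tmul y w =>
    rw [stageEval_tmul, forget, LinearMap.comp_apply, LinearMap.lTensor_tmul, tensorEval_snoc]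
    rfl

variable {φ}

/-- The evaluated stage is the trace of the last generating matrix, transported past all sites,
times the holonomy of the elements of `S` met so far. The general functional `β` makes the induction
work: a further step of the process changes `β` only. -/
theorem stageEval_stage (hφ : SitesCommute φ) (hq : q ≠ 0) (hτ : IsTauR q (tauR q)) {S : Set ℕ}
    {a : ℕ} (hS : ∀ i ∈ S, a ≤ i) (k : ℕ) (β : IR q →ₗ[𝕂] 𝒜)
    (hβ : ∀ i < a + k, ∀ u w, Commute (φ i u) (β w)) :
    stageEval φ a k β (stage q S a k)
      = qTrace q (unitConj (pathTransport φ (a + k)) ((genMatIR q).map β)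
          * setHolonomy φ S (a + k)) := by
  induction k generalizing β with
  | zero =>
    have h1 : setHolonomy φ S (a + 0) = 1 := setHolonomy_of_forall_le hS
    rw [h1, mul_one, qTrace_conj_path hφ hq _ fun i hi => commutesWithSite_genMatIR_map (hβ i hi),
      qTrace_genMatIR q hq, stage, stageEval_tmul, tensorEval_one, one_mul]
  | succ k ih =>
    have hk : ∀ u w, Commute (φ (a + k) u) (β w) := hβ (a + k) (by omega)
    have hβ' : ∀ (f : IR q →ₐ[𝕂] Uq q ⊗[𝕂] IR q), ∀ i < a + k, ∀ u w,
        Commute (φ i u) ((pairing (φ (a + k)) β ∘ₗ f.toLinearMap) w) := fun f i hi u w =>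
      commute_pairing (fun v => hφ i (a + k) hi.ne u v) (fun w => hβ i (by omega) u w) (f w)
    rw [stage, stageEval_applyLast, ih _ (hβ' _), ← add_assoc, unitConj_pathTransport_succ]
    split_ifs with hkS
    · rw [genMatIR_map_pairing_delta hq hk, setHolonomy, if_pos hkS, holonomy,
        ← unitConj_mul_unitConj, mul_assoc]
    · rw [genMatIR_map_pairing_tau hq hτ hk, setHolonomy, if_neg hkS]

end Evaluation

/-! ### `Λ_A` as the trace of a holonomy -/

section Sites

variable {𝕂 : Type*} [Field 𝕂] (q : 𝕂)

/-- The counit of `U_q(sl_2)`. -/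
def counit : Uq q →ₐ[𝕂] 𝕂 :=
  RingQuot.liftAlgHom 𝕂 ⟨FreeAlgebra.lift 𝕂 fun
    | UqGen.E => 0
    | UqGen.F => 0
    | UqGen.K => 1
    | UqGen.Kinv => 1, fun x y h => by induction h <;> simp⟩

/-- The embedding of `U_q(sl_2)` as the `i`-th factor of the tensor power. Beyond the last factor
it is the counit, which keeps different sites commuting for all indices. -/
def site (n i : ℕ) : Uq q →ₐ[𝕂] ⨂[𝕂]^n (Uq q) :=
  if h : i < n then PiTensorProduct.singleAlgHom (R := 𝕂) (A := fun _ : Fin n => Uq q) ⟨i, h⟩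
  else (Algebra.ofId 𝕂 _).comp (counit q)

theorem site_of_lt {n i : ℕ} (h : i < n) (u : Uq q) :
    site q n i u = PiTensorProduct.tprod 𝕂 (Pi.mulSingle (⟨i, h⟩ : Fin n) u) := by
  rw [site, dif_pos h]
  rfl

theorem sitesCommute_site (n : ℕ) : SitesCommute (site q n) := by
  intro i j hij u v
  by_cases hi : i < n
  · by_cases hj : j < n
    · rw [site_of_lt q hi, site_of_lt q hj, Commute, SemiconjBy, PiTensorProduct.tprod_mul_tprod,
        PiTensorProduct.tprod_mul_tprod]
      congr 1
      exact Pi.mulSingle_commute (f := fun _ : Fin n => Uq q) (by simpa using hij) u v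
    · have h : site q n j v = algebraMap 𝕂 _ (counit q v) := by
        rw [site, dif_neg hj]; rfl
      rw [h]
      exact Algebra.commute_algebraMap_right _ _
  · have h : site q n i u = algebraMap 𝕂 _ (counit q u) := by
      rw [site, dif_neg hi]; rfl
    rw [h]
    exact Algebra.commute_algebraMap_left _ _

theorem prod_ofFn_site {n : ℕ} (x : Fin n → Uq q) (m : ℕ) (hm : m ≤ n) :
    (List.ofFn fun i : Fin m => site q n i (x (Fin.castLE hm i))).prod
      = PiTensorProduct.tprod 𝕂 fun i : Fin n => if (i : ℕ) < m then x i else 1 := by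
  induction m with
  | zero => simp [PiTensorProduct.one_def, Pi.one_def]
  | succ m ih =>
    rw [List.ofFn_succ', List.concat_eq_append, List.prod_append, List.prod_singleton]
    have h := ih (by omega)
    simp only [Fin.val_castSucc, Fin.val_last] at h ⊢
    erw [h]
    rw [site_of_lt q hm, PiTensorProduct.tprod_mul_tprod]
    congr 1
    funext i
    rcases lt_trichotomy (i : ℕ) m with hi | hi | hi
    · have : i ≠ ⟨m, hm⟩ := fun h => hi.ne (congrArg Fin.val h)
      simp [hi, hi.trans m.lt_succ_self, this]
    · have : i = ⟨m, hm⟩ := Fin.ext hi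
      subst this
      simp
      rfl
    · have : i ≠ ⟨m, hm⟩ := fun h => hi.ne' (congrArg Fin.val h)
      simp [hi.not_gt, this, hi.not_ge]

theorem tensorEval_site (n : ℕ) (x : ⨂[𝕂]^n (Uq q)) : tensorEval (site q n) 0 n x = x := by
  induction x using PiTensorProduct.induction_on with
  | add x y hx hy => rw [map_add, hx, hy]
  | smul_tprod r x =>
    rw [map_smul, tensorEval_tprod]
    congr 1
    have h := prod_ofFn_site q x n le_rfl
    simp only [Fin.is_lt, if_true] at h
    simp only [zero_add]
    exact h

/-- `Λ_A` is the quantum trace of the holonomy of `A`. -/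
theorem Lam_eq_qTrace (hq : q ≠ 0) (hτ : IsTauR q (tauR q)) (n : ℕ) (A : Finset (Fin n)) :
    Lam q n A = qTrace q (setHolonomy (site q n) (Fin.val '' (A : Set (Fin n))) n) := by
  by_cases h : A.Nonempty
  · have hφ := sitesCommute_site q n
    rw [Lam, dif_pos h]
    dsimp only
    set a := A.min' h
    set m := A.max' h
    set S := Fin.val '' (A : Set (Fin n)) with hS
    have ham : (a : ℕ) ≤ m := Fin.le_def.mp (A.min'_le_max' h)
    have hSa : ∀ i ∈ S, (a : ℕ) ≤ i := by
      rintro _ ⟨i, hi, rfl⟩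
      exact Fin.le_def.mp (A.min'_le i hi)
    have hSm : ∀ i ∈ S, i < (m : ℕ) + 1 := by
      rintro _ ⟨i, hi, rfl⟩
      exact Nat.lt_succ_of_le (Fin.le_def.mp (A.le_max' i hi))
    have hmS : (m : ℕ) ∈ S := ⟨m, A.max'_mem h, rfl⟩
    rw [← tensorEval_site q n (TensorPower.cast 𝕂 (Uq q) _ _), tensorEval_cast,
      tensorEval_concat, tensorEval_concat, tensorEval_one, tensorEval_one, one_mul, mul_one,
      zero_add, stageEval_forget, stageEval_stage hφ hq hτ hSa]
    · have e : (a : ℕ) + (m - a) = m := by omega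
      rw [e, setHolonomy_of_forall_lt hSm m.isLt, setHolonomy, if_pos hmS, holonomy,
        ← genMatIR_map]
      rfl
    · intro i hi u w
      exact hφ i _ hi.ne u _
  · rw [Lam, dif_neg h, setHolonomy_of_forall_le, qTrace_one]
    rw [Finset.not_nonempty_iff_eq_empty.mp h]
    simp

end Sites

/-! ### Existence of the coaction -/

section ExistenceOfCoaction

open PowerSeries

variable {𝕂 : Type*} [Field 𝕂]

/-- Conjugation by a unit, as an algebra morphism. -/
def conjAlgHom {B : Type*} [Ring B] [Algebra 𝕂 B] (ν : Bˣ) : B →ₐ[𝕂] B where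
  toFun := unitConj ν
  map_one' := by simp [unitConj]
  map_mul' x y := (unitConj_mul_unitConj ν x y).symm
  map_zero' := by simp [unitConj]
  map_add' x y := by simp [unitConj, mul_add, add_mul]
  commutes' r := by
    rw [unitConj, ← Algebra.commutes, mul_assoc, Units.mul_inv, mul_one]

/-- Constant power series, as an algebra morphism. -/
def constAlgHom (B : Type*) [Ring B] [Algebra 𝕂 B] : B →ₐ[𝕂] B⟦X⟧ where
  __ := PowerSeries.C (R := B)
  commutes' _ := PowerSeries.algebraMap_apply.symm

/-- Polynomials over `A` as power series over `B`, along a morphism of the coefficients. -/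
def polyToSeries {A B : Type*} [Ring A] [Algebra 𝕂 A] [Ring B] [Algebra 𝕂 B] (f : A →ₐ[𝕂] B) :
    Polynomial A →ₐ[𝕂] B⟦X⟧ where
  __ := (PowerSeries.map f.toRingHom).comp Polynomial.coeToPowerSeries.ringHom
  commutes' r := by
    ext n
    simp [Polynomial.algebraMap_apply, PowerSeries.algebraMap_apply]

/-- Evaluation of polynomials at `1`, over a ring that need not be commutative. -/
def evalAtOne (A : Type*) [Ring A] [Algebra 𝕂 A] : Polynomial A →ₐ[𝕂] A where
  __ := Polynomial.eval₂RingHom' (RingHom.id A) 1 fun _ => Commute.one_right _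
  commutes' r := by simp [Polynomial.algebraMap_apply]

section

variable {A B : Type*} [Ring A] [Algebra 𝕂 A] [Ring B] [Algebra 𝕂 B] (f : A →ₐ[𝕂] B)

theorem coeff_polyToSeries (p : Polynomial A) (n : ℕ) :
    coeff n (polyToSeries f p) = f (p.coeff n) := by
  change coeff n (PowerSeries.map f.toRingHom (p : A⟦X⟧)) = _
  rw [PowerSeries.coeff_map, Polynomial.coeff_coe]
  rfl

theorem polyToSeries_injective (hf : Function.Injective f) :
    Function.Injective (polyToSeries f) := fun p r h => by
  ext n
  apply hf
  rw [← coeff_polyToSeries, h, coeff_polyToSeries]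

theorem polyToSeries_C (a : A) : polyToSeries f (Polynomial.C a) = PowerSeries.C (f a) := by
  ext n
  rw [coeff_polyToSeries, Polynomial.coeff_C, PowerSeries.coeff_C]
  split_ifs <;> simp

theorem polyToSeries_X : polyToSeries f Polynomial.X = PowerSeries.X := by
  ext n
  rw [coeff_polyToSeries, Polynomial.coeff_X, PowerSeries.coeff_X]
  simp only [eq_comm (a := 1)]
  split_ifs <;> simp

theorem evalAtOne_C (a : A) : evalAtOne (𝕂 := 𝕂) A (Polynomial.C a) = a := by
  simp [evalAtOne]

theorem evalAtOne_X : evalAtOne (𝕂 := 𝕂) A Polynomial.X = 1 := by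
  simp [evalAtOne]

end

variable (q : 𝕂)

/-- The values of `cartanCoaction` on the generators. -/
def cartanGen : UqGen → Uq q ⊗[𝕂] Uq q
  | UqGen.E => genKinv q ⊗ₜ genE q
  | UqGen.F => genK q ⊗ₜ genF q
  | UqGen.K => 1 ⊗ₜ genK q
  | UqGen.Kinv => 1 ⊗ₜ genKinv q

theorem cartanGen_rel ⦃x y : FreeAlgebra 𝕂 UqGen⦄ (h : UqRel q x y) :
    FreeAlgebra.lift 𝕂 (cartanGen q) x = FreeAlgebra.lift 𝕂 (cartanGen q) y := by
  induction h with
  | K_mul_Kinv => simp [cartanGen, genK_mul_genKinv, Algebra.TensorProduct.one_def]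
  | Kinv_mul_K => simp [cartanGen, genKinv_mul_genK, Algebra.TensorProduct.one_def]
  | K_mul_E => simp [cartanGen, genK_mul_genE]
  | K_mul_F => simp [cartanGen, genK_mul_genF]
  | E_F =>
    simp only [map_mul, map_sub, map_smul, FreeAlgebra.lift_ι_apply, cartanGen,
      Algebra.TensorProduct.tmul_mul_tmul, genKinv_mul_genK, genK_mul_genKinv,
      ← TensorProduct.tmul_sub, genE_genF, TensorProduct.tmul_smul]

/-- The algebra morphism which has the leading terms of the coaction as values on `E K⁻¹`, `F`,
`K⁻¹` and `Λ`. -/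
def cartanCoaction : Uq q →ₐ[𝕂] Uq q ⊗[𝕂] Uq q :=
  RingQuot.liftAlgHom 𝕂 ⟨FreeAlgebra.lift 𝕂 (cartanGen q), cartanGen_rel q⟩

theorem cartanCoaction_mkUq (x : FreeAlgebra 𝕂 UqGen) :
    cartanCoaction q (mkUq q x) = FreeAlgebra.lift 𝕂 (cartanGen q) x :=
  RingQuot.liftAlgHom_mkAlgHom_apply 𝕂 _ (cartanGen_rel q) x

theorem cartanCoaction_genE : cartanCoaction q (genE q) = genKinv q ⊗ₜ genE q := by
  rw [genE, cartanCoaction_mkUq, FreeAlgebra.lift_ι_apply]; rfl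

theorem cartanCoaction_genF : cartanCoaction q (genF q) = genK q ⊗ₜ genF q := by
  rw [genF, cartanCoaction_mkUq, FreeAlgebra.lift_ι_apply]; rfl

theorem cartanCoaction_genK : cartanCoaction q (genK q) = 1 ⊗ₜ genK q := by
  rw [genK, cartanCoaction_mkUq, FreeAlgebra.lift_ι_apply]; rfl

theorem cartanCoaction_genKinv : cartanCoaction q (genKinv q) = 1 ⊗ₜ genKinv q := by
  rw [genKinv, cartanCoaction_mkUq, FreeAlgebra.lift_ι_apply]; rfl

theorem cartanCoaction_casimir : cartanCoaction q (casimir q) = 1 ⊗ₜ casimir q := by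
  simp only [casimir, map_add, map_smul, map_mul, cartanCoaction_genE, cartanCoaction_genF,
    cartanCoaction_genK, cartanCoaction_genKinv, Algebra.TensorProduct.tmul_mul_tmul,
    genKinv_mul_genK, TensorProduct.tmul_add, TensorProduct.tmul_smul]

/-- The coefficients of the quasi-`R`-matrix. -/
def thetaCoeff : ℕ → 𝕂
  | 0 => 1
  | m + 1 => q * (q - q⁻¹) ^ 2 / (1 - q ^ (2 * (m + 1))) * thetaCoeff m

/-- The quasi-`R`-matrix `∑ c_m F^m ⊗ E^m X^m`. The formal variable replaces the completion in which
the sum would otherwise have to be taken. -/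
def theta : (Uq q ⊗[𝕂] Uq q)⟦X⟧ :=
  PowerSeries.mk fun m => thetaCoeff q m • ((genF q ^ m) ⊗ₜ (genE q ^ m))

/-- The quasi-`R`-matrix as a unit of the ring of power series. -/
def thetaUnit : ((Uq q ⊗[𝕂] Uq q)⟦X⟧)ˣ where
  val := theta q
  inv := PowerSeries.invOfUnit (theta q) 1
  val_inv := PowerSeries.mul_invOfUnit _ _ (by simp [theta, thetaCoeff,
    ← Algebra.TensorProduct.one_def])
  inv_val := PowerSeries.invOfUnit_mul _ _ (by simp [theta, thetaCoeff,
    ← Algebra.TensorProduct.one_def])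

variable {q}

theorem genK_mul_genF_pow (m : ℕ) :
    genK q * genF q ^ m = (q ^ (2 * m))⁻¹ • (genF q ^ m * genK q) := by
  induction m with
  | zero => simp
  | succ m ih =>
    rw [pow_succ, ← mul_assoc, ih, smul_mul_assoc, mul_assoc, genK_mul_genF, mul_smul_comm,
      smul_smul, ← mul_assoc]
    congr 1
    rw [← mul_inv, ← pow_add]
    rfl

theorem genKinv_mul_genF_pow (hq : q ≠ 0) (m : ℕ) :
    genKinv q * genF q ^ m = q ^ (2 * m) • (genF q ^ m * genKinv q) := by
  induction m with
  | zero => simp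
  | succ m ih =>
    rw [pow_succ, ← mul_assoc, ih, smul_mul_assoc, mul_assoc, genKinv_mul_genF hq, mul_smul_comm,
      smul_smul, ← mul_assoc, ← pow_add]
    rfl

theorem genE_pow_mul_genKinv (m : ℕ) :
    genE q ^ m * genKinv q = q ^ (2 * m) • (genKinv q * genE q ^ m) := by
  induction m with
  | zero => simp
  | succ m ih =>
    rw [pow_succ, mul_assoc, genE_mul_genKinv, mul_smul_comm, ← mul_assoc, ih, smul_mul_assoc,
      smul_smul, mul_assoc, ← pow_add, mul_add, mul_one, add_comm]

theorem genE_pow_succ_mul_genF (hq : q ≠ 0) (k : ℕ) :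
    (q - q⁻¹) ^ 2 • (genE q ^ (k + 1) * genF q)
      = (q - q⁻¹) ^ 2 • (genF q * genE q ^ (k + 1))
        + (q * (1 - (q ^ (2 * (k + 1)))⁻¹)) • (genK q * genE q ^ k)
        + (q⁻¹ * (1 - q ^ (2 * (k + 1)))) • (genKinv q * genE q ^ k) := by
  induction k with
  | zero =>
    simp only [zero_add, pow_one, pow_zero, mul_one, genE_mul_genF]
    match_scalars <;> field_simp
    ring
  | succ k ih =>
    rw [pow_succ' _ (k + 1), mul_assoc, ← mul_smul_comm, ih]
    simp only [mul_add, mul_smul_comm, ← mul_assoc, genE_mul_genF, genE_mul_genK hq,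
      genE_mul_genKinv, add_mul, sub_mul, smul_mul_assoc]
    simp only [mul_assoc, ← pow_succ']
    match_scalars <;> field_simp <;> ring

theorem casimir_eq (hq : q ≠ 0) : casimir q
    = (q - q⁻¹) ^ 2 • (genF q * genE q) + q • genK q + q⁻¹ • genKinv q := by
  rw [casimir, genE_mul_genF]
  match_scalars <;> field_simp <;> ring

theorem genE_commute_casimir (hq : q ≠ 0) : Commute (genE q) (casimir q) := by
  rw [Commute, SemiconjBy]
  nth_rewrite 1 [casimir_eq hq]
  rw [casimir]
  simp only [mul_add, mul_smul_comm, ← mul_assoc, add_mul, smul_mul_assoc, genE_mul_genK hq,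
    genE_mul_genKinv]
  match_scalars <;> field_simp

theorem thetaCoeff_succ (hq : ∀ k : ℕ, 0 < k → q ^ k ≠ 1) (m : ℕ) :
    thetaCoeff q (m + 1) * (1 - q ^ (2 * (m + 1))) = q * (q - q⁻¹) ^ 2 * thetaCoeff q m := by
  have h : 1 - q ^ (2 * (m + 1)) ≠ 0 := sub_ne_zero.mpr (hq _ (by positivity)).symm
  rw [thetaCoeff]
  field_simp

theorem coeff_theta (m : ℕ) :
    coeff m (theta q) = thetaCoeff q m • ((genF q ^ m) ⊗ₜ (genE q ^ m)) :=
  PowerSeries.coeff_mk _ _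

theorem theta_mul_cartanCoaction_irE (hq : q ≠ 0) :
    theta q * PowerSeries.C (genKinv q ⊗ₜ (genE q * genKinv q))
      = PowerSeries.C (genKinv q ⊗ₜ (genE q * genKinv q)) * theta q := by
  ext m
  rw [coeff_mul_C, coeff_C_mul, coeff_theta, smul_mul_assoc, mul_smul_comm,
    Algebra.TensorProduct.tmul_mul_tmul, Algebra.TensorProduct.tmul_mul_tmul,
    genKinv_mul_genF_pow hq, ← mul_assoc, ← pow_succ, genE_pow_mul_genKinv, genE_mul_genKinv,
    smul_mul_assoc, mul_assoc, ← pow_succ']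
  simp only [TensorProduct.tmul_smul, ← TensorProduct.smul_tmul', smul_smul, ← pow_add]
  ring_nf

theorem theta_mul_cartanCoaction_irC (hq : q ≠ 0) :
    theta q * PowerSeries.C (1 ⊗ₜ casimir q) = PowerSeries.C (1 ⊗ₜ casimir q) * theta q := by
  ext m
  rw [coeff_mul_C, coeff_C_mul, coeff_theta, smul_mul_assoc, mul_smul_comm,
    Algebra.TensorProduct.tmul_mul_tmul, Algebra.TensorProduct.tmul_mul_tmul, mul_one, one_mul,
    ((genE_commute_casimir hq).pow_left m).eq]

theorem theta_mul_cartanCoaction_irK (hq₀ : q ≠ 0) (hq : ∀ k : ℕ, 0 < k → q ^ k ≠ 1) :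
    theta q * PowerSeries.C (1 ⊗ₜ genKinv q)
      = (PowerSeries.C (1 ⊗ₜ genKinv q) - PowerSeries.X * PowerSeries.C
          ((q⁻¹ * (q - q⁻¹) ^ 2) • (genF q ⊗ₜ (genE q * genKinv q)))) * theta q := by
  ext m
  rw [sub_mul, map_sub, coeff_mul_C, coeff_C_mul, mul_assoc]
  cases m with
  | zero => simp [coeff_theta, thetaCoeff]
  | succ m =>
    rw [coeff_succ_X_mul, coeff_C_mul, coeff_theta, coeff_theta]
    have h := thetaCoeff_succ hq m
    simp only [smul_mul_assoc, mul_smul_comm, Algebra.TensorProduct.tmul_mul_tmul, mul_one,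
      one_mul, genE_pow_mul_genKinv, genE_mul_genKinv, mul_assoc, ← pow_succ',
      TensorProduct.tmul_smul, smul_smul]
    rw [← sub_smul]
    congr 1
    field_simp at h ⊢
    linear_combination -h

theorem theta_mul_cartanCoaction_irF (hq₀ : q ≠ 0) (hq : ∀ k : ℕ, 0 < k → q ^ k ≠ 1) :
    theta q * PowerSeries.C (genK q ⊗ₜ genF q)
      = (PowerSeries.C (genK q ⊗ₜ genF q)
          + PowerSeries.X * (PowerSeries.C
            ((q⁻¹ * (q + q⁻¹)) • ((genF q * genK q) ⊗ₜ genKinv q)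
              - q⁻¹ • ((genF q * genK q) ⊗ₜ casimir q))
            - PowerSeries.X * PowerSeries.C (((q ^ 3)⁻¹ * (q - q⁻¹) ^ 2) •
              ((genF q ^ 2 * genK q) ⊗ₜ (genE q * genKinv q))))) * theta q := by
  ext m
  rw [add_mul, map_add, coeff_mul_C, coeff_C_mul, mul_assoc]
  cases m with
  | zero => simp [coeff_theta, thetaCoeff]
  | succ m =>
    have hz : (q - q⁻¹) ^ 2 ≠ 0 := pow_ne_zero 2 (sub_inv_ne_zero hq hq₀)
    have hm : 1 - q ^ (2 * (m + 1)) ≠ 0 := sub_ne_zero.mpr (hq _ (by positivity)).symm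
    have hEF : genE q ^ (m + 1) * genF q = genF q * genE q ^ (m + 1)
        + ((q - q⁻¹) ^ 2)⁻¹ • ((q * (1 - (q ^ (2 * (m + 1)))⁻¹)) • (genK q * genE q ^ m)
          + (q⁻¹ * (1 - q ^ (2 * (m + 1)))) • (genKinv q * genE q ^ m)) := by
      rw [← inv_smul_smul₀ hz (genE q ^ (m + 1) * genF q), genE_pow_succ_mul_genF hq₀, add_assoc,
        smul_add, inv_smul_smul₀ hz]
    -- The term of degree two, in terms of `c_m` by the recursion; both sides vanish for `m = 0`.
    have hd : coeff m (PowerSeries.X * PowerSeries.C (((q ^ 3)⁻¹ * (q - q⁻¹) ^ 2) •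
          ((genF q ^ 2 * genK q) ⊗ₜ[𝕂] (genE q * genKinv q))) * theta q)
        = ((q ^ (2 * m))⁻¹ * (1 - q ^ (2 * m)) * thetaCoeff q m) •
          ((genF q ^ (m + 1) * genK q) ⊗ₜ (genKinv q * genE q ^ m)) := by
      rw [mul_assoc]
      cases m with
      | zero => simp
      | succ k =>
        have h := thetaCoeff_succ hq k
        rw [coeff_succ_X_mul, coeff_C_mul, coeff_theta]
        simp only [smul_mul_assoc, mul_smul_comm, Algebra.TensorProduct.tmul_mul_tmul, mul_assoc,
          genK_mul_genF_pow, genE_mul_genKinv, ← pow_succ', TensorProduct.tmul_smul,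
          ← TensorProduct.smul_tmul', smul_smul]
        rw [← mul_assoc (genF q ^ 2), ← pow_add, add_comm 2 k]
        congr 1
        rw [mul_comm (1 - q ^ (2 * (k + 1))), h]
        field_simp
        ring
    rw [coeff_succ_X_mul, sub_mul, map_sub, hd, coeff_C_mul, coeff_theta, coeff_theta,
      smul_mul_assoc, Algebra.TensorProduct.tmul_mul_tmul, hEF, casimir_eq hq₀]
    have h' : thetaCoeff q (m + 1)
        = q * (q - q⁻¹) ^ 2 * thetaCoeff q m / (1 - q ^ (2 * (m + 1))) := by
      rw [eq_div_iff hm, thetaCoeff_succ hq]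
    rw [h']
    simp only [smul_mul_assoc, mul_smul_comm, add_mul, sub_mul,
      Algebra.TensorProduct.tmul_mul_tmul, mul_assoc,
      genK_mul_genF_pow, ← pow_succ', TensorProduct.tmul_smul, TensorProduct.tmul_add,
      ← TensorProduct.smul_tmul', smul_smul]
    simp only [← mul_assoc (genF q), ← pow_succ']
    have hq2 : q ^ 2 - 1 ≠ 0 := sub_ne_zero.mpr (hq 2 two_pos)
    match_scalars <;> field_simp <;> ring

/-- Conjugation of `cartanCoaction` by the quasi-`R`-matrix gives polynomials on the generators of
`I_R`, hence on `I_R`; their values at `X = 1` form the coaction. -/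
theorem exists_isTauR (hq₀ : q ≠ 0) (hq : ∀ k : ℕ, 0 < k → q ^ k ≠ 1) : ∃ τ, IsTauR q τ := by
  let ι := polyToSeries (inclR q)
  have hι : Function.Injective ι := polyToSeries_injective _ (inclR_injective q)
  let Φ : Uq q →ₐ[𝕂] (Uq q ⊗[𝕂] Uq q)⟦X⟧ :=
    ((conjAlgHom (thetaUnit q)).comp (constAlgHom _)).comp (cartanCoaction q)
  have hΦ : ∀ x p, theta q * PowerSeries.C (cartanCoaction q x) = ι p * theta q → Φ x = ι p := by
    intro x p h
    change theta q * PowerSeries.C (cartanCoaction q x) * _ = _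
    rw [h]
    exact Units.mul_inv_cancel_right _ (thetaUnit q)
  have hE : Φ (irE q : Uq q) = ι (Polynomial.C (genKinv q ⊗ₜ irE q)) := by
    apply hΦ
    rw [polyToSeries_C, inclR_tmul, irE, map_mul, cartanCoaction_genE, cartanCoaction_genKinv,
      Algebra.TensorProduct.tmul_mul_tmul, mul_one]
    exact theta_mul_cartanCoaction_irE hq₀
  have hC : Φ (irC q : Uq q) = ι (Polynomial.C (1 ⊗ₜ irC q)) := by
    apply hΦ
    rw [polyToSeries_C, inclR_tmul, irC, cartanCoaction_casimir]
    exact theta_mul_cartanCoaction_irC hq₀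
  have hK : Φ (irK q : Uq q) = ι (Polynomial.C (1 ⊗ₜ irK q) - Polynomial.X * Polynomial.C
      ((q⁻¹ * (q - q⁻¹) ^ 2) • (genF q ⊗ₜ irE q))) := by
    apply hΦ
    rw [map_sub, map_mul, polyToSeries_C, polyToSeries_C, polyToSeries_X, map_smul, inclR_tmul,
      inclR_tmul, irK, irE, cartanCoaction_genKinv]
    exact theta_mul_cartanCoaction_irK hq₀ hq
  have hF : Φ (irF q : Uq q) = ι (Polynomial.C (genK q ⊗ₜ irF q)
          + Polynomial.X * (Polynomial.C
            ((q⁻¹ * (q + q⁻¹)) • ((genF q * genK q) ⊗ₜ irK q)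
              - q⁻¹ • ((genF q * genK q) ⊗ₜ irC q))
            - Polynomial.X * Polynomial.C (((q ^ 3)⁻¹ * (q - q⁻¹) ^ 2) •
              ((genF q ^ 2 * genK q) ⊗ₜ irE q)))) := by
    apply hΦ
    rw [map_add, map_mul, map_sub, map_mul, polyToSeries_C, polyToSeries_C, polyToSeries_C,
      polyToSeries_X, map_sub, map_smul, map_smul, map_smul]
    simp only [inclR_tmul, irK, irE, irF, irC, cartanCoaction_genF]
    exact theta_mul_cartanCoaction_irF hq₀ hq
  have hmem : ∀ x : IR q, Φ (x : Uq q) ∈ ι.range := by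
    have h : IR q ≤ ι.range.comap Φ := by
      refine Algebra.adjoin_le ?_
      rintro y (rfl | rfl | rfl | rfl)
      exacts [⟨_, hE.symm⟩, ⟨_, hF.symm⟩, ⟨_, hK.symm⟩, ⟨_, hC.symm⟩]
    exact fun x => h x.2
  let ψ : IR q →ₐ[𝕂] Polynomial (Uq q ⊗[𝕂] IR q) :=
    ((AlgEquiv.ofInjective ι hι).symm : _ →ₐ[𝕂] _).comp
      ((Φ.comp (IR q).val).codRestrict ι.range hmem)
  have hψ : ∀ (x : IR q) p, Φ (x : Uq q) = ι p → ψ x = p := by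
    intro x p h
    have h' := AlgEquiv.apply_symm_apply (AlgEquiv.ofInjective ι hι) ⟨Φ (x : Uq q), hmem x⟩
    exact hι ((congrArg Subtype.val h').trans h)
  refine ⟨(evalAtOne _).comp ψ, ?_, ?_, ?_, ?_⟩
  · rw [AlgHom.comp_apply, hψ _ _ hE, evalAtOne_C]
  · rw [AlgHom.comp_apply, hψ _ _ hF]
    simp only [map_add, map_mul, map_sub, evalAtOne_C, evalAtOne_X, one_mul]
    abel
  · rw [AlgHom.comp_apply, hψ _ _ hK]
    simp only [map_mul, map_sub, evalAtOne_C, evalAtOne_X, one_mul]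
  · rw [AlgHom.comp_apply, hψ _ _ hC, evalAtOne_C]

theorem isTauR_tauR (hq₀ : q ≠ 0) (hq : ∀ k : ℕ, 0 < k → q ^ k ≠ 1) : IsTauR q (tauR q) := by
  have h := exists_isTauR hq₀ hq
  rw [tauR, dif_pos h]
  exact h.choose_spec

end ExistenceOfCoaction

/-! ### The relations between the `Λ_A` -/

section Main

variable {𝕂 : Type*} [Field 𝕂] (q : 𝕂) (n : ℕ)

/-- The holonomy of `A` in the `n`-th tensor power. -/
def orderedHolonomy (A : Finset (Fin n)) : Mat2 (⨂[𝕂]^n (Uq q)) :=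
  setHolonomy (site q n) (Fin.val '' (A : Set (Fin n))) n

variable {q n}

theorem isHolonomy_orderedHolonomy (hq : q ≠ 0) (A : Finset (Fin n)) :
    IsHolonomy q (orderedHolonomy q n A) :=
  isHolonomy_setHolonomy (sitesCommute_site q n) hq _ _

theorem Prec.val_lt {A B : Finset (Fin n)} (h : Prec A B) :
    ∀ i ∈ Fin.val '' (A : Set (Fin n)), ∀ j ∈ Fin.val '' (B : Set (Fin n)), i < j := by
  rintro _ ⟨a, ha, rfl⟩ _ ⟨b, hb, rfl⟩
  exact h a ha b hb

theorem Prec.precedes (hq : q ≠ 0) {A B : Finset (Fin n)} (h : Prec A B) :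
    Precedes q (orderedHolonomy q n B) (orderedHolonomy q n A) :=
  precedes_setHolonomy (sitesCommute_site q n) hq h.val_lt n

theorem orderedHolonomy_union {A B : Finset (Fin n)} (h : Prec A B) :
    orderedHolonomy q n (A ∪ B) = orderedHolonomy q n B * orderedHolonomy q n A := by
  rw [orderedHolonomy, Finset.coe_union, Set.image_union, setHolonomy_union h.val_lt]
  rfl

theorem Prec.union_left {A B C : Finset (Fin n)} (h : Prec A C) (h' : Prec B C) :
    Prec (A ∪ B) C := fun a ha => (Finset.mem_union.mp ha).elim (h a) (h' a)

theorem Prec.disjoint {A B : Finset (Fin n)} (h : Prec A B) : Disjoint A B :=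
  Finset.disjoint_left.mpr fun a ha hb => lt_irrefl a (h a ha a hb)

end Main

end

end AskeyWilson

open AskeyWilson in
theorem theorem3p3 {𝕂 : Type*} [Field 𝕂] (q : 𝕂) (hq₀ : q ≠ 0)
    (hq : ∀ k : ℕ, 0 < k → q ^ k ≠ 1) (n : ℕ) (A₁ A₂ A₃ A₄ : Finset (Fin n))
    (h₁₂ : AskeyWilson.Prec A₁ A₂) (h₁₃ : AskeyWilson.Prec A₁ A₃) (h₁₄ : AskeyWilson.Prec A₁ A₄)
    (h₂₃ : AskeyWilson.Prec A₂ A₃) (h₂₄ : AskeyWilson.Prec A₂ A₄) (h₃₄ : AskeyWilson.Prec A₃ A₄) :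
    AskeyWilson.StandardRelation q (A₁ ∪ A₂ ∪ A₄) (A₂ ∪ A₃) ∧
    AskeyWilson.StandardRelation q (A₂ ∪ A₃) (A₁ ∪ A₃ ∪ A₄) ∧
    AskeyWilson.StandardRelation q (A₁ ∪ A₃ ∪ A₄) (A₁ ∪ A₂ ∪ A₄) := by
  have hL (A : Finset (Fin n)) : Lam q n A = qTrace q (orderedHolonomy q n A) :=
    Lam_eq_qTrace q hq₀ (isTauR_tauR hq₀ hq) n A
  have d₁₂ := Finset.disjoint_left.mp h₁₂.disjoint
  have d₁₃ := Finset.disjoint_left.mp h₁₃.disjoint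
  have d₁₄ := Finset.disjoint_left.mp h₁₄.disjoint
  have d₂₃ := Finset.disjoint_left.mp h₂₃.disjoint
  have d₂₄ := Finset.disjoint_left.mp h₂₄.disjoint
  have d₃₄ := Finset.disjoint_left.mp h₃₄.disjoint
  have hH := isHolonomy_orderedHolonomy (q := q) (n := n) hq₀
  have u₁₂ := orderedHolonomy_union (q := q) h₁₂
  have u₁₃ := orderedHolonomy_union (q := q) h₁₃
  have u₁₄ := orderedHolonomy_union (q := q) h₁₄
  have u₂₃ := orderedHolonomy_union (q := q) h₂₃
  have u₁₂₃ := orderedHolonomy_union (q := q) (h₁₃.union_left h₂₃)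
  have u₁₂₄ := orderedHolonomy_union (q := q) (h₁₄.union_left h₂₄)
  have u₁₃₄ := orderedHolonomy_union (q := q) (h₁₄.union_left h₃₄)
  have u₁₂₃₄ := orderedHolonomy_union (q := q) ((h₁₄.union_left h₂₄).union_left h₃₄)
  simp only [StandardRelation, hL]
  refine ⟨?_, ?_, ?_⟩
  · have s₁ : (A₁ ∪ A₂ ∪ A₄ ∪ (A₂ ∪ A₃)) \ ((A₁ ∪ A₂ ∪ A₄) ∩ (A₂ ∪ A₃)) = A₁ ∪ A₃ ∪ A₄ := by
      ext a
      grind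
    have s₂ : (A₁ ∪ A₂ ∪ A₄) ∩ (A₂ ∪ A₃) = A₂ := by ext a; grind
    have s₃ : A₁ ∪ A₂ ∪ A₄ ∪ (A₂ ∪ A₃) = A₁ ∪ A₂ ∪ A₃ ∪ A₄ := by ext a; grind
    have s₄ : (A₁ ∪ A₂ ∪ A₄) \ A₂ = A₁ ∪ A₄ := by ext a; grind
    have s₅ : (A₂ ∪ A₃) \ A₂ = A₃ := by ext a; grind
    rw [s₁, s₂, s₃, s₄, s₅, u₁₂₄, u₁₂, u₂₃, u₁₃₄, u₁₃, u₁₂₃₄, u₁₂₃, u₁₂, u₁₄]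
    have := qComm_qTrace_of_shared_third hq₀ (hH A₂) (h₃₄.precedes hq₀)
      (h₂₄.precedes hq₀) (h₂₃.precedes hq₀) (h₁₃.precedes hq₀) (h₁₂.precedes hq₀)
    simpa only [mul_assoc] using this
  · have s₁ : (A₂ ∪ A₃ ∪ (A₁ ∪ A₃ ∪ A₄)) \ ((A₂ ∪ A₃) ∩ (A₁ ∪ A₃ ∪ A₄)) = A₁ ∪ A₂ ∪ A₄ := by
      ext a
      grind
    have s₂ : (A₂ ∪ A₃) ∩ (A₁ ∪ A₃ ∪ A₄) = A₃ := by ext a; grind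
    have s₃ : A₂ ∪ A₃ ∪ (A₁ ∪ A₃ ∪ A₄) = A₁ ∪ A₂ ∪ A₃ ∪ A₄ := by ext a; grind
    have s₄ : (A₁ ∪ A₃ ∪ A₄) \ A₃ = A₁ ∪ A₄ := by ext a; grind
    have s₅ : (A₂ ∪ A₃) \ A₃ = A₂ := by ext a; grind
    rw [s₁, s₂, s₃, s₄, s₅, u₁₂₄, u₁₂, u₂₃, u₁₃₄, u₁₃, u₁₂₃₄, u₁₂₃, u₁₂, u₁₄]
    have := qComm_qTrace_of_shared_second hq₀ (hH A₃) (h₃₄.precedes hq₀)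
      (h₂₄.precedes hq₀) (h₂₃.precedes hq₀) (h₁₃.precedes hq₀) (h₁₂.precedes hq₀)
    simpa only [mul_assoc] using this
  · have s₁ : (A₁ ∪ A₃ ∪ A₄ ∪ (A₁ ∪ A₂ ∪ A₄)) \ ((A₁ ∪ A₃ ∪ A₄) ∩ (A₁ ∪ A₂ ∪ A₄))
        = A₂ ∪ A₃ := by
      ext a
      grind
    have s₂ : (A₁ ∪ A₃ ∪ A₄) ∩ (A₁ ∪ A₂ ∪ A₄) = A₁ ∪ A₄ := by ext a; grind
    have s₃ : A₁ ∪ A₃ ∪ A₄ ∪ (A₁ ∪ A₂ ∪ A₄) = A₁ ∪ A₂ ∪ A₃ ∪ A₄ := by ext a; grind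
    have s₄ : (A₁ ∪ A₃ ∪ A₄) \ (A₁ ∪ A₄) = A₃ := by ext a; grind
    have s₅ : (A₁ ∪ A₂ ∪ A₄) \ (A₁ ∪ A₄) = A₂ := by ext a; grind
    rw [s₁, s₂, s₃, s₄, s₅, u₁₂₄, u₁₂, u₂₃, u₁₃₄, u₁₃, u₁₂₃₄, u₁₂₃, u₁₂, u₁₄]
    have := qComm_qTrace_of_shared_outer hq₀ (hH A₄) (hH A₁) (h₃₄.precedes hq₀) (h₂₄.precedes hq₀)
      (h₁₄.precedes hq₀) (h₂₃.precedes hq₀) (h₁₃.precedes hq₀) (h₁₂.precedes hq₀)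
    simpa only [mul_assoc] using this
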